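/- **Setting.** Let $1\le K<C$ and $N\ge 1$ be integers, $\mathcal X$ a measurable space, $\mathcal Y=\{0,1\}^C$, $\mathcal D$ a probability measure on $\mathcal X\times\mathcal Y$, and $\mathcal S=((\boldsymbol x^{(n)},\boldsymbol y^{(n)}))_{n\le N}$ an i.i.d. sample from $\mathcal D$. For $\boldsymbol y\in\mathcal Y$ let $\mathcal P(\boldsymbol y)=\{i: y_i=1\}$ and $N(\boldsymbol y)=|\mathcal P(\boldsymbol y)|$, and assume $N(\boldsymbol y)\le K$ almost surely. Let $\mathbb H$ be a real Hilbert space and $\phi:\mathcal X\to\mathbb H$ a (strongly measurable) feature map of a kernel $\kappa_0$, i.e. $\kappa_0(\boldsymbol x,\boldsymbol x')=\langle\phi(\boldsymbol x),\phi(\boldsymbol x')\rangle$ (for instance $\mathbb H$ the RKHS of $\kappa_0$), with $\kappa_0(\boldsymbol x,\boldsymbol x)\le r^2$ for all $\boldsymbol x$, where $r>0$. For $\Lambda\ge 0$ let $$\mathcal F_{\mathbb H}=\Big\{\boldsymbol x\mapsto(\langle \boldsymbol w_j,\phi(\boldsymbol x)\rangle)_{j\le C}\ :\ \Big(\sum_{j\le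 C}\|\boldsymbol w_j\|_{\mathbb H}^2\Big)^{1/2}\le\Lambda\Big\}.$$ Let $I\subseteq\mathbb R$ contain all score differences $f(\boldsymbol x)_i-f(\boldsymbol x)_j$, $f\in\mathcal F_{\mathbb H}$, $\boldsymbol x\in\mathcal X$, $i,j\le C$, and let $\ell:\mathbb R\to\mathbb R$ be, on $I$, nonnegative, differentiable, strictly decreasing, convex, $\mu_\ell$-Lipschitz and bounded above by $M_\ell$ (in particular $I$ is convex). With $N_K=\min\{K,N(\boldsymbol y)\}$ let $\alpha$ be one of $\alpha_1=1$, $\alpha_2=N_K$, $\alpha_3=N_K(2K+1-N_K)/2$. For $\boldsymbol s=f(\boldsymbol x)$, with $s_{[k]}$ the $k$-th largest entry of $\boldsymbol s$, put $$L_K^{\alpha,\ell}(f,\boldsymbol y)=\frac1{\alpha K}\sum_{y\in\mathcal P(\boldsymbol y)}\sum_{k\le K+1}\ell(s_y-s_{[k]})$$ (which is $0$ if $N(\boldsymbol y)=0$), $\mathcal R_K^{\alpha,\ell}(f)=\mathbb E_{\mathcal D}L_K^{\alpha,\ell}(f,\boldsymbol y)$, and $$\Phi(L_K^{\alpha,\ell},\delta)=\frac1N\sum_{n\le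 N}L_K^{\alpha,\ell}(f,\boldsymbol y^{(n)})+3M_K\sqrt{\frac{\log(2/\delta)}{2N}},$$ where $M_K=(K+1)M_\ell$ for $\alpha_1,\alpha_2$ and $M_K=\frac{K+1}{K}M_\ell$ for $\alpha_3$. **Exponential label counts.** Let $\pi_q(\mathcal S)$ be the fraction of samples in $\mathcal S$ with $N(\boldsymbol y)=q$ and $p_q$ the probability that $N(\boldsymbol y)=q$ under $\mathcal D$. Let $\lambda,c,\kappa>0$ with $c\sum_{q=1}^Ke^{-\lambda q}\le1$. A family $(\rho_q)$ is called *exponential* here if $\rho_q\le\kappa\, c\,e^{-\lambda q}$ for $1\le q\le K$. (The case $\rho_q=c\,e^{-\lambda q}$, $1\le q\le K$, is included with $\kappa=1$; the sum condition then only says that the masses add up to at most one, the rest being the samples without relevant labels.) **Statement.** There is an absolute constant $A>0$ such that in every such setting $L_K^{\alpha,\ell}(f,\boldsymbol y)$ is $\mathcal D$-integrable for every $f\in\mathcal F_{\mathbb H}$, and the following holds for every $\delta\in(0,1)$. Consider the bound $$\mathcal R_K^{\alpha,\ell}(f)\le\Phi(L_K^{\alpha,\ell},\delta)+A\,\mu_\ell\sqrt{\kappa(1+c)}\cdot\begin{cases}\sqrt{\dfrac{C\Lambda^2r^2}{N\lambda^4}},&\alpha=\alpha_1,\\[2mm]\sqrt{\dfrac{C\Lambda^2r^2}{Ne^\lambda}},&\alpha=\alpha_2,\\[2mm]\sqrt{\dfrac{C\Lambda^2r^2}{NK^2e^\lambda}},&\alpha=\alpha_3.\end{cases}\qquad(*)$$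 1. With probability at least $1-\delta$ over $\mathcal S$: if $(\pi_q(\mathcal S))_q$ is exponential, then $(*)$ holds for all $f\in\mathcal F_{\mathbb H}$. 2. If $(p_q)_q$ is exponential, then with probability at least $1-\delta$ over $\mathcal S$, $(*)$ holds for all $f\in\mathcal F_{\mathbb H}$. (The exceptional set of samples has outer probability at most $\delta$.) -/

import Mathlib

open MeasureTheory

noncomputable section

namespace TKPR

/-- A label vector in `{0,1}^C`. -/
abbrev Label (C : ℕ) : Type := Fin C → Bool

/-- The set of relevant labels of `y`. -/
def relevant {C : ℕ} (y : Label C) : Finset (Fin C) :=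
  Finset.univ.filter fun i => y i = true

/-- The number of relevant labels of `y`. -/
def numRelevant {C : ℕ} (y : Label C) : ℕ := (relevant y).card

/-- The scores in descending order: `topEntry s k` is the `(k+1)`-th largest entry of `s`
(the index `k : Fin C` starts at `0`). -/
def topEntry {C : ℕ} (s : Fin C → ℝ) (k : Fin C) : ℝ := s (Tuple.sort s (Fin.rev k))

/-- The three choices of the weighting term. -/
inductive Weighting
  | one
  | two
  | three

/-- The weighting term as a function of the number `q` of relevant labels, with
`q_K = min K q`: it is `1`, `q_K`, or `q_K (2K + 1 - q_K) / 2`. -/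
def Weighting.alpha (a : Weighting) (K q : ℕ) : ℝ :=
  match a with
  | .one => 1
  | .two => (min K q : ℕ)
  | .three => ((min K q : ℕ) : ℝ) * (2 * (K : ℝ) + 1 - ((min K q : ℕ) : ℝ)) / 2

/-- The top-`K` pairwise ranking surrogate loss
`(1 / (α K)) ∑_{y relevant} ∑_{k ≤ K + 1} ℓ (s_y - s_[k])` (positions `k` start at `0` here).
It is `0` when there is no relevant label. -/
def surrogateLoss {C : ℕ} (a : Weighting) (K : ℕ) (ell : ℝ → ℝ) (s : Fin C → ℝ)
    (y : Label C) : ℝ :=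
  1 / (a.alpha K (numRelevant y) * (K : ℝ)) *
    ∑ i ∈ relevant y, ∑ k ∈ Finset.univ.filter (fun k : Fin C => (k : ℕ) < K + 1),
      ell (s i - topEntry s k)

/-- The bound of the surrogate loss, for `ell` bounded by `M`. -/
def Weighting.lossBound (a : Weighting) (K : ℕ) (M : ℝ) : ℝ :=
  match a with
  | .one => ((K : ℝ) + 1) * M
  | .two => ((K : ℝ) + 1) * M
  | .three => ((K : ℝ) + 1) / (K : ℝ) * M

/-- The surrogate risk of a score function `f` under the joint distribution `D`. -/
def risk {X : Type*} [MeasurableSpace X] {C : ℕ} (D : Measure (X × Label C)) (a : Weighting)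
    (K : ℕ) (ell : ℝ → ℝ) (f : X → Fin C → ℝ) : ℝ :=
  ∫ z, surrogateLoss a K ell (f z.1) z.2 ∂D

/-- The empirical surrogate risk of `f` on the data set `S`. -/
def empiricalRisk {X : Type*} {C N : ℕ} (S : Fin N → X × Label C) (a : Weighting)
    (K : ℕ) (ell : ℝ → ℝ) (f : X → Fin C → ℝ) : ℝ :=
  1 / (N : ℝ) * ∑ n, surrogateLoss a K ell (f (S n).1) (S n).2

/-- The empirical risk plus the confidence term: `M` is the bound of `ell`. -/
def Phi {X : Type*} {C N : ℕ} (S : Fin N → X × Label C) (a : Weighting)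
    (K : ℕ) (ell : ℝ → ℝ) (M δ : ℝ) (f : X → Fin C → ℝ) : ℝ :=
  empiricalRisk S a K ell f
    + 3 * a.lossBound K M * √(Real.log (2 / δ) / (2 * (N : ℝ)))

/-- The score function `x ↦ Wᵀ φ(x)` of the parameters `W = (w_1, …, w_C)`. -/
def kernelModel {X H : Type*} [NormedAddCommGroup H] [InnerProductSpace ℝ H] {C : ℕ}
    (φ : X → H) (W : Fin C → H) : X → Fin C → ℝ :=
  fun x j => inner ℝ (W j) (φ x)

/-- The norm `(∑_j ‖w_j‖²)^{1/2}`. -/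
def paramNorm {H : Type*} [NormedAddCommGroup H] {C : ℕ} (W : Fin C → H) : ℝ :=
  √(∑ j, ‖W j‖ ^ 2)

/-- The kernel-based models with parameters of norm at most `Λ`. -/
def kernelClass {X H : Type*} [NormedAddCommGroup H] [InnerProductSpace ℝ H] (C : ℕ)
    (φ : X → H) (Λ : ℝ) : Set (X → Fin C → ℝ) :=
  {f | ∃ W : Fin C → H, paramNorm W ≤ Λ ∧ f = kernelModel φ W}

/-- The conditions on the surrogate `ell`, on a set `I` of score differences: nonnegative,
differentiable, strictly decreasing, convex, `μ`-Lipschitz and bounded by `M`. -/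
structure IsSurrogate (ell : ℝ → ℝ) (I : Set ℝ) (μ : NNReal) (M : ℝ) : Prop where
  nonneg : ∀ t ∈ I, 0 ≤ ell t
  differentiable : DifferentiableOn ℝ ell I
  strictAnti : StrictAntiOn ell I
  convex : ConvexOn ℝ I ell
  lipschitz : LipschitzOnWith μ ell I
  le_bound : ∀ t ∈ I, ell t ≤ M

/-- The ratio of samples in `S` with exactly `q` relevant labels. -/
def sampleRatio {X : Type*} {C N : ℕ} (S : Fin N → X × Label C) (q : ℕ) : ℝ :=
  ((Finset.univ.filter fun n => numRelevant (S n).2 = q).card : ℝ) / (N : ℝ)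

/-- The probability under `D` that a sample has exactly `q` relevant labels. -/
def populationRatio {X : Type*} [MeasurableSpace X] {C : ℕ} (D : Measure (X × Label C))
    (q : ℕ) : ℝ :=
  D.real {z | numRelevant z.2 = q}

/-- The label-count ratios `π_q`, `1 ≤ q ≤ K`, are, up to a factor `κ`, at most those of the
exponential law `c e^{-λ q}`. -/
def ExpLabelCount (K : ℕ) (lam c κ : ℝ) (ratio : ℕ → ℝ) : Prop :=
  ∀ q ∈ Finset.Icc 1 K, ratio q ≤ κ * (c * Real.exp (-(lam * (q : ℝ))))

/-- The complexity term of the generalization bound. -/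
def Weighting.rate (a : Weighting) (C N K : ℕ) (Λ r lam : ℝ) : ℝ :=
  match a with
  | .one => √((C : ℝ) * Λ ^ 2 * r ^ 2 / ((N : ℝ) * lam ^ 4))
  | .two => √((C : ℝ) * Λ ^ 2 * r ^ 2 / ((N : ℝ) * Real.exp lam))
  | .three => √((C : ℝ) * Λ ^ 2 * r ^ 2 / ((N : ℝ) * (K : ℝ) ^ 2 * Real.exp lam))

end TKPR

end

/-! The proof is uniform convergence by Rademacher averages, with a separate Lipschitz constant for
each sample. Symmetrization and McDiarmid's inequality (`measure_deviation_le`) yield one event of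
probability at least 1 - δ on which the gap between risk and empirical risk is controlled both by
the empirical Rademacher average and by its expectation. The first bound serves the hypothesis on
the sample ratios, the second the one on the population ratios.

`vector_contraction` replaces the loss at sample n by its linear scores, at the price of a factor 2
(from Khintchine's inequality) and of that sample's own Lipschitz constant G_n. Cauchy–Schwarz and
the orthogonality of signs then give 2Λr√(C ∑ G_n²) in `rademacher_linear_le`. By
`abs_truncLoss_sub_le`, a sample with q relevant labels, 1 ≤ q ≤ K, has G_n = 4μw_q with w_q = q, 1
or 1/K for the three weightings. Thus ∑ G_n² is 16μ²N ∑ π_q w_q², and exponential decay of π_q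
bounds ∑ π_q w_q² by a multiple of κ(1+c) times λ⁻⁴, e^{-λ} or K⁻²e^{-λ}
(`sum_ratio_mul_lipWeight_sq_le`). A worst-case Lipschitz constant would lose this dependence on λ.

Three reductions make this applicable. The surrogate is replaced by a bounded Lipschitz function on
the whole line; the loss is set to zero at label counts above K, which have probability zero; and
suprema are taken over finite families only, the full ball being reached through a countable family
and closedness. No uncountable supremum has to be measured. -/

open scoped BigOperators

namespace TKPR

/-! ### Rademacher signs and Khintchine's inequality -/

/-- The Rademacher sign of a bit. -/
def sgn (b : Bool) : ℝ := if b then 1 else -1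

@[simp] lemma sgn_not (b : Bool) : sgn (!b) = -sgn b := by cases b <;> simp [sgn]

@[simp] lemma sgn_mul_self (b : Bool) : sgn b * sgn b = 1 := by cases b <;> simp [sgn]

lemma abs_sgn (b : Bool) : |sgn b| = 1 := by cases b <;> simp [sgn]

lemma expect_bool (F : Bool → ℝ) : (𝔼 b, F b) = (F true + F false) / 2 := by
  rw [Fintype.expect_eq_sum_div_card]
  simp

lemma expect_cons {α : Type*} [Fintype α] {n : ℕ} (F : (Fin (n + 1) → α) → ℝ) :
    (𝔼 η, F η) = 𝔼 a : α, 𝔼 η : Fin n → α, F (Fin.cons a η) := by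
  rw [← Finset.expect_product', Finset.univ_product_univ]
  exact (Fintype.expect_equiv (Fin.consEquiv fun _ => α) _ _ fun _ => rfl).symm

/-- Invariance of the uniform distribution on the cube under a global sign change. -/
lemma expect_flip {ι : Type*} [Fintype ι] [DecidableEq ι] (F : (ι → Bool) → ℝ) :
    (𝔼 η : ι → Bool, F fun i => !η i) = 𝔼 η, F η := by
  refine Fintype.expect_equiv
    (Function.Involutive.toPerm (fun η i => !η i) fun η => by simp) _ _ fun _ => rfl

/-- Distinct Rademacher signs are uncorrelated. -/
lemma expect_sgn_mul_sgn {ι : Type*} [Fintype ι] [DecidableEq ι] (k l : ι) :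
    (𝔼 η : ι → Bool, sgn (η k) * sgn (η l)) = if k = l then 1 else 0 := by
  split_ifs with h
  · subst h
    simp
  -- Flipping coordinate `k` alone permutes the cube and negates the product, so its mean vanishes.
  · have hinv : Function.Involutive fun η : ι → Bool => Function.update η k (!η k) := by
      intro η
      simp
    have := Fintype.expect_equiv hinv.toPerm
      (fun η : ι → Bool => -(sgn (η k) * sgn (η l))) (fun η => sgn (η k) * sgn (η l)) fun η => by
        simp [Function.Involutive.toPerm, Function.update_of_ne (Ne.symm h)]
    rw [Finset.expect_neg_distrib] at this
    linarith

lemma expect_norm_sq_signed_sum {ι : Type*} [Fintype ι] [DecidableEq ι] {E : Type*}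
    [NormedAddCommGroup E] [InnerProductSpace ℝ E] (v : ι → E) :
    (𝔼 η : ι → Bool, ‖∑ k, sgn (η k) • v k‖ ^ 2) = ∑ k, ‖v k‖ ^ 2 := by
  have h : ∀ η : ι → Bool, ‖∑ k, sgn (η k) • v k‖ ^ 2
      = ∑ k, ∑ l, sgn (η k) * sgn (η l) * inner ℝ (v k) (v l) := by
    intro η
    rw [← real_inner_self_eq_norm_sq, sum_inner]
    simp only [inner_sum]
    refine Finset.sum_congr rfl fun k _ => Finset.sum_congr rfl fun l _ => ?_
    rw [real_inner_smul_left, real_inner_smul_right, mul_assoc]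
  simp only [h]
  rw [Finset.expect_sum_comm]
  refine Finset.sum_congr rfl fun k _ => ?_
  rw [Finset.expect_sum_comm]
  simp only [← Finset.expect_mul, expect_sgn_mul_sgn, ite_mul, one_mul, zero_mul,
    Finset.sum_ite_eq, Finset.mem_univ, if_true, real_inner_self_eq_norm_sq]

lemma expect_sq_signed_sum {n : ℕ} (v : Fin n → ℝ) :
    (𝔼 η : Fin n → Bool, (∑ k, sgn (η k) * v k) ^ 2) = ∑ k, v k ^ 2 := by
  simpa using expect_norm_sq_signed_sum v

/-- Averaging over the first sign kills the odd powers: with S the remaining sum and Q = E S², what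
is left is v₀⁴ + 6v₀²Q + E S⁴, and 3(v₀² + Q)² exceeds this by at least 2v₀⁴ when E S⁴ ≤ 3Q². -/
lemma expect_pow_four_signed_sum_le {n : ℕ} (v : Fin n → ℝ) :
    (𝔼 η : Fin n → Bool, (∑ k, sgn (η k) * v k) ^ 4) ≤ 3 * (∑ k, v k ^ 2) ^ 2 := by
  induction n with
  | zero => simp
  | succ n ih =>
    have h2 := expect_sq_signed_sum fun k => v (Fin.succ k)
    have h4 := ih fun k => v (Fin.succ k)
    rw [expect_cons, expect_bool, ← Finset.expect_add_distrib]
    simp only [Fin.sum_univ_succ, Fin.cons_zero, Fin.cons_succ]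
    have h : ∀ η : Fin n → Bool,
        (sgn true * v 0 + ∑ k : Fin n, sgn (η k) * v k.succ) ^ 4
          + (sgn false * v 0 + ∑ k : Fin n, sgn (η k) * v k.succ) ^ 4
        = 2 * v 0 ^ 4 + 12 * v 0 ^ 2 * (∑ k : Fin n, sgn (η k) * v k.succ) ^ 2
          + 2 * (∑ k : Fin n, sgn (η k) * v k.succ) ^ 4 := by
      intro η
      simp only [sgn]
      norm_num
      ring
    simp only [h]
    rw [Finset.expect_add_distrib, Finset.expect_add_distrib, ← Finset.mul_expect,
      ← Finset.mul_expect, ← Finset.mul_expect, h2, Fintype.expect_const]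
    nlinarith [sq_nonneg (v 0 ^ 2)]

/-- Khintchine's inequality for the first moment, with constant `2`. -/
lemma sqrt_sum_sq_le_expect_abs {n : ℕ} (v : Fin n → ℝ) :
    √(∑ k, v k ^ 2) ≤ 2 * 𝔼 η : Fin n → Bool, |∑ k, sgn (η k) * v k| := by
  set σ := √(∑ k, v k ^ 2) with hσ
  have hσ0 : 0 ≤ σ := Real.sqrt_nonneg _
  have hσ2 : ∑ k, v k ^ 2 = σ ^ 2 := (Real.sq_sqrt (by positivity)).symm
  have hE : 0 ≤ 𝔼 η : Fin n → Bool, |∑ k, sgn (η k) * v k| :=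
    Finset.expect_nonneg fun _ _ => abs_nonneg _
  rcases hσ0.eq_or_lt with h0 | hpos
  · rw [← h0]; positivity
  -- A minorant of |x| that involves only second and fourth moments. In expectation the left side is
  -- at least 6σ⁴ - 3σ⁴, whence the constant 2.
  have hpt : ∀ x : ℝ, 6 * σ ^ 2 * x ^ 2 - x ^ 4 ≤ 6 * σ ^ 3 * |x| := by
    intro x
    have hy : 0 ≤ |x| := abs_nonneg x
    rw [← sq_abs x, show x ^ 4 = |x| ^ 4 from (Even.pow_abs (by decide) x).symm]
    generalize |x| = y at hy
    have : 0 ≤ y ^ 3 - 6 * y * σ ^ 2 + 6 * σ ^ 3 := by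
      -- On y ≥ 0 the cubic is smallest at y = √2 σ; the rational 1.42 approximates √2, and the
      -- small remaining terms are positive.
      have e : y ^ 3 - 6 * y * σ ^ 2 + 6 * σ ^ 3
          = (y - 1.42 * σ) ^ 2 * (y + 2.84 * σ) + 0.0492 * (y * σ ^ 2)
            + 0.273424 * σ ^ 3 := by ring
      rw [e]; positivity
    nlinarith [mul_nonneg hy this]
  have hsum : 6 * σ ^ 2 * (𝔼 η : Fin n → Bool, (∑ k, sgn (η k) * v k) ^ 2)
      - (𝔼 η : Fin n → Bool, (∑ k, sgn (η k) * v k) ^ 4)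
      ≤ 6 * σ ^ 3 * 𝔼 η : Fin n → Bool, |∑ k, sgn (η k) * v k| := by
    rw [Finset.mul_expect, Finset.mul_expect, ← Finset.expect_sub_distrib]
    exact Finset.expect_le_expect fun η _ => hpt _
  have h4 := expect_pow_four_signed_sum_le v
  rw [expect_sq_signed_sum, hσ2] at hsum
  rw [hσ2] at h4
  have : σ ^ 3 * σ ≤ σ ^ 3 * (2 * 𝔼 η : Fin n → Bool, |∑ k, sgn (η k) * v k|) := by nlinarith
  exact le_of_mul_le_mul_left this (by positivity)

/-! ### Vector contraction -/

lemma le_iSup_fintype {ι : Type*} [Finite ι] (u : ι → ℝ) (i : ι) : u i ≤ ⨆ i, u i :=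
  le_ciSup (Set.finite_range u).bddAbove i

/-- One step of the vector contraction inequality. -/
lemma contraction_step {ι : Type*} [Finite ι] [Nonempty ι] {C : ℕ} (u ψ : ι → ℝ)
    (v : ι → Fin C → ℝ) {G : ℝ} (hG : 0 ≤ G)
    (hψ : ∀ i i', |ψ i - ψ i'| ≤ G * √(∑ j, (v i j - v i' j) ^ 2)) :
    (𝔼 b : Bool, ⨆ i, (u i + sgn b * ψ i))
      ≤ 𝔼 η : Fin C → Bool, ⨆ i, (u i + 2 * G * ∑ j, sgn (η j) * v i j) := by
  set T : (Fin C → Bool) → ℝ := fun η => ⨆ i, (u i + 2 * G * ∑ j, sgn (η j) * v i j) with hT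
  obtain ⟨i, hi⟩ := exists_eq_ciSup_of_finite (f := fun i => u i + sgn true * ψ i)
  obtain ⟨i', hi'⟩ := exists_eq_ciSup_of_finite (f := fun i => u i + sgn false * ψ i)
  rw [expect_bool, ← hi, ← hi']
  -- Testing the suprema at η and -η with the two maximizers, in whichever order is favourable,
  -- produces the absolute value. Its mean is at least half the Euclidean norm by Khintchine, so the
  -- factor 2 in front of `G` pays for |ψ i - ψ i'|.
  have key : ∀ η : Fin C → Bool,
      u i + u i' + 2 * G * |∑ j, sgn (η j) * (v i j - v i' j)| ≤ T η + T fun j => !η j := by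
    intro η
    have a1 := le_iSup_fintype (fun i => u i + 2 * G * ∑ j, sgn (η j) * v i j) i
    have a2 := le_iSup_fintype (fun i => u i + 2 * G * ∑ j, sgn (η j) * v i j) i'
    have a3 := le_iSup_fintype (fun i => u i + 2 * G * ∑ j, sgn (!η j) * v i j) i
    have a4 := le_iSup_fintype (fun i => u i + 2 * G * ∑ j, sgn (!η j) * v i j) i'
    simp only [sgn_not, neg_mul, Finset.sum_neg_distrib] at a3 a4
    simp only [hT, sgn_not, neg_mul, Finset.sum_neg_distrib, mul_sub, Finset.sum_sub_distrib]
    rcases abs_cases ((∑ j, sgn (η j) * v i j) - ∑ j, sgn (η j) * v i' j) with h | h <;>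
      rw [h.1] <;> linarith
  have hsum : u i + u i' + 2 * G * 𝔼 η : Fin C → Bool, |∑ j, sgn (η j) * (v i j - v i' j)|
      ≤ 2 * 𝔼 η, T η := by
    have := Finset.expect_le_expect (s := Finset.univ) fun η _ => key η
    rw [Finset.expect_add_distrib, ← Finset.mul_expect, Fintype.expect_const,
      Finset.expect_add_distrib, expect_flip T] at this
    linarith
  have hk := mul_le_mul_of_nonneg_left (sqrt_sum_sq_le_expect_abs fun j => v i j - v i' j) hG
  have := (le_abs_self _).trans (hψ i i')
  simp only [sgn, if_true, Bool.false_eq_true, if_false]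
  linarith

/-- The vector contraction inequality for Rademacher averages. -/
theorem vector_contraction {ι : Type*} [Finite ι] [Nonempty ι] {C N : ℕ} (u : ι → ℝ)
    (ψ : Fin N → ι → ℝ) (v : Fin N → ι → Fin C → ℝ) (G : Fin N → ℝ) (hG : ∀ n, 0 ≤ G n)
    (hψ : ∀ n i i', |ψ n i - ψ n i'| ≤ G n * √(∑ j, (v n i j - v n i' j) ^ 2)) :
    (𝔼 ε : Fin N → Bool, ⨆ i, (u i + ∑ n, sgn (ε n) * ψ n i))
      ≤ 𝔼 η : Fin N → Fin C → Bool,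
          ⨆ i, (u i + ∑ n, 2 * G n * ∑ j, sgn (η n j) * v n i j) := by
  -- The offset `u` absorbs the samples not being treated: first the untouched losses in the
  -- one-sample step, then the already linearized sample in the induction hypothesis.
  induction N generalizing u with
  | zero => simp
  | succ N ih =>
    rw [expect_cons, expect_cons, Finset.expect_comm]
    simp only [Fin.sum_univ_succ, Fin.cons_zero, Fin.cons_succ]
    calc _ ≤ 𝔼 ε : Fin N → Bool, 𝔼 η₀ : Fin C → Bool, ⨆ i,
            (u i + ∑ n : Fin N, sgn (ε n) * ψ n.succ i
              + 2 * G 0 * ∑ j, sgn (η₀ j) * v 0 i j) := by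
          refine Finset.expect_le_expect fun ε _ => ?_
          have := contraction_step (fun i => u i + ∑ n : Fin N, sgn (ε n) * ψ n.succ i) (ψ 0)
            (v 0) (hG 0) (hψ 0)
          refine le_trans (le_of_eq ?_) this
          simp only [add_assoc, add_comm (sgn _ * ψ 0 _)]
      _ = 𝔼 η₀ : Fin C → Bool, 𝔼 ε : Fin N → Bool, ⨆ i,
            ((u i + 2 * G 0 * ∑ j, sgn (η₀ j) * v 0 i j)
              + ∑ n : Fin N, sgn (ε n) * ψ n.succ i) := by
          rw [Finset.expect_comm]
          simp only [add_right_comm]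
      _ ≤ _ := by
          refine Finset.expect_le_expect fun η₀ _ => ?_
          have := ih (fun i => u i + 2 * G 0 * ∑ j, sgn (η₀ j) * v 0 i j)
            (fun n => ψ n.succ) (fun n => v n.succ) (fun n => G n.succ) (fun n => hG _)
            (fun n => hψ _)
          simpa only [add_assoc] using this

/-! ### Rademacher averages of linear classes -/

lemma sq_expect_le {α : Type*} [Fintype α] [Nonempty α] (F : α → ℝ) :
    (𝔼 a, F a) ^ 2 ≤ 𝔼 a, F a ^ 2 := by
  have h : 0 ≤ 𝔼 a, (F a - 𝔼 b, F b) ^ 2 := Finset.expect_nonneg fun _ _ => sq_nonneg _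
  simp only [sub_sq] at h
  rw [Finset.expect_add_distrib, Finset.expect_sub_distrib, Fintype.expect_const,
    ← Finset.expect_mul, ← Finset.mul_expect] at h
  nlinarith

/-- The Rademacher averages of losses that are Lipschitz in the scores of a linear class. -/
theorem rademacher_linear_le {ι E : Type*} [Finite ι] [Nonempty ι] [NormedAddCommGroup E]
    [InnerProductSpace ℝ E] {C N : ℕ} (W : ι → Fin C → E) {Λ r : ℝ}
    (hΛ : ∀ i, paramNorm (W i) ≤ Λ) (x : Fin N → E) (hr : 0 ≤ r) (hx : ∀ n, ‖x n‖ ≤ r)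
    (ψ : Fin N → ι → ℝ) (G : Fin N → ℝ) (hG : ∀ n, 0 ≤ G n)
    (hψ : ∀ n i i', |ψ n i - ψ n i'|
      ≤ G n * √(∑ j, (inner ℝ (W i j) (x n) - inner ℝ (W i' j) (x n)) ^ 2)) :
    (𝔼 ε : Fin N → Bool, ⨆ i, ∑ n, sgn (ε n) * ψ n i)
      ≤ 2 * Λ * r * √(C * ∑ n, G n ^ 2) := by
  have hΛ0 : 0 ≤ Λ := (Real.sqrt_nonneg _).trans (hΛ (Classical.arbitrary ι))
  have h1 := vector_contraction (fun _ : ι => 0) ψ (fun n i j => inner ℝ (W i j) (x n)) G hG hψ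
  simp only [zero_add] at h1
  refine h1.trans ?_
  -- After the sums are exchanged, the score functional is the inner product of `W i` with this
  -- vector in E^C, so Cauchy–Schwarz removes the supremum.
  set V : (Fin N → Fin C → Bool) → Fin C → E :=
    fun η j => ∑ n, sgn (η n j) • ((2 * G n) • x n) with hV
  have h2 : ∀ η : Fin N → Fin C → Bool,
      (⨆ i, ∑ n, 2 * G n * ∑ j, sgn (η n j) * inner ℝ (W i j) (x n))
        ≤ Λ * √(∑ j, ‖V η j‖ ^ 2) := by
    intro η
    refine ciSup_le fun i => ?_
    have e : ∑ n, 2 * G n * ∑ j, sgn (η n j) * inner ℝ (W i j) (x n)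
        = ∑ j, inner ℝ (W i j) (V η j) := by
      simp only [hV, inner_sum, real_inner_smul_right, Finset.mul_sum]
      rw [Finset.sum_comm]
      exact Finset.sum_congr rfl fun _ _ => Finset.sum_congr rfl fun _ _ => by ring
    rw [e]
    calc ∑ j, inner ℝ (W i j) (V η j) ≤ ∑ j, ‖W i j‖ * ‖V η j‖ :=
          Finset.sum_le_sum fun j _ => real_inner_le_norm _ _
      _ ≤ √(∑ j, ‖W i j‖ ^ 2) * √(∑ j, ‖V η j‖ ^ 2) := Real.sum_mul_le_sqrt_mul_sqrt _ _ _
      _ ≤ _ := mul_le_mul_of_nonneg_right (hΛ i) (Real.sqrt_nonneg _)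
  refine (Finset.expect_le_expect fun η _ => h2 η).trans ?_
  rw [← Finset.mul_expect]
  have hcol : ∀ j : Fin C, (𝔼 η : Fin N → Fin C → Bool, ‖V η j‖ ^ 2)
      ≤ ∑ n, 4 * G n ^ 2 * r ^ 2 := by
    intro j
    have e1 : (𝔼 η : Fin N → Fin C → Bool, ‖V η j‖ ^ 2)
        = ∑ n, ‖(2 * G n) • x n‖ ^ 2 := by
      have h : ∀ η : Fin N → Fin C → Bool, ‖V η j‖ ^ 2
          = ∑ k, ∑ l, sgn (η k j) * sgn (η l j)
              * inner ℝ ((2 * G k) • x k) ((2 * G l) • x l) := by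
        intro η
        rw [hV, ← real_inner_self_eq_norm_sq, sum_inner]
        simp only [inner_sum]
        refine Finset.sum_congr rfl fun k _ => Finset.sum_congr rfl fun l _ => ?_
        rw [real_inner_smul_left (_ • _), real_inner_smul_right _ (_ • _), mul_assoc]
      have hs : ∀ k l : Fin N, (𝔼 η : Fin N → Fin C → Bool, sgn (η k j) * sgn (η l j))
          = if k = l then 1 else 0 := by
        -- Currying identifies these signs with independent signs on pairs; within the fixed column
        -- `j`, distinct samples remain uncorrelated.
        intro k l
        have h0 := expect_sgn_mul_sgn (k, j) (l, j)
        simp only [Prod.mk.injEq, and_true] at h0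
        rw [← h0]
        exact (Fintype.expect_equiv (Equiv.curry (Fin N) (Fin C) Bool) _ _ fun _ => rfl).symm
      simp only [h]
      rw [Finset.expect_sum_comm]
      refine Finset.sum_congr rfl fun k _ => ?_
      rw [Finset.expect_sum_comm]
      simp only [← Finset.expect_mul, hs, ite_mul, one_mul, zero_mul,
        Finset.sum_ite_eq, Finset.mem_univ, if_true, real_inner_self_eq_norm_sq]
    rw [e1]
    refine Finset.sum_le_sum fun n _ => ?_
    rw [norm_smul, mul_pow, Real.norm_eq_abs, sq_abs, mul_pow]
    have := pow_le_pow_left₀ (norm_nonneg _) (hx n) 2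
    have := mul_le_mul_of_nonneg_left this (by positivity : (0 : ℝ) ≤ 2 ^ 2 * G n ^ 2)
    linarith
  have h3 : (𝔼 η : Fin N → Fin C → Bool, √(∑ j, ‖V η j‖ ^ 2))
      ≤ 2 * r * √(C * ∑ n, G n ^ 2) := by
    -- Jensen moves the mean inside the root. The `C` columns share one bound, which is the source
    -- of the factor √C.
    have hle := sq_expect_le fun η : Fin N → Fin C → Bool => √(∑ j, ‖V η j‖ ^ 2)
    have e : ∀ η, √(∑ j, ‖V η j‖ ^ 2) ^ 2 = ∑ j, ‖V η j‖ ^ 2 := fun η =>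
      Real.sq_sqrt (by positivity)
    simp only [e] at hle
    rw [Finset.expect_sum_comm] at hle
    have hle2 := hle.trans (Finset.sum_le_sum fun j _ => hcol j)
    refine (Real.le_sqrt_of_sq_le hle2).trans (le_of_eq ?_)
    rw [Finset.sum_const, Finset.card_univ, Fintype.card_fin, nsmul_eq_mul, ← Finset.sum_mul,
      ← Finset.mul_sum, show (C : ℝ) * (4 * (∑ n, G n ^ 2) * r ^ 2)
        = (2 * r) ^ 2 * (C * ∑ n, G n ^ 2) by ring, Real.sqrt_mul (by positivity),
      Real.sqrt_sq (by positivity)]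
  calc _ ≤ Λ * (2 * r * √(C * ∑ n, G n ^ 2)) := mul_le_mul_of_nonneg_left h3 hΛ0
    _ = _ := by ring

/-! ### Elementary bounds on suprema, averages and integrals -/

lemma abs_iSup_sub_iSup_le {ι : Type*} [Finite ι] [Nonempty ι] {f g : ι → ℝ} {c : ℝ}
    (h : ∀ i, |f i - g i| ≤ c) : |(⨆ i, f i) - ⨆ i, g i| ≤ c := by
  rw [abs_sub_le_iff]
  constructor
  · rw [sub_le_iff_le_add]
    exact ciSup_le fun i => by
      have := le_iSup_fintype g i
      have := (abs_sub_le_iff.1 (h i)).1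
      linarith
  · rw [sub_le_iff_le_add]
    exact ciSup_le fun i => by
      have := le_iSup_fintype f i
      have := (abs_sub_le_iff.1 (h i)).2
      linarith

lemma abs_iSup_le_of_abs_le {ι : Type*} [Finite ι] [Nonempty ι] {f : ι → ℝ} {c : ℝ}
    (h : ∀ i, |f i| ≤ c) : |⨆ i, f i| ≤ c := by
  simpa using abs_iSup_sub_iSup_le (f := f) (g := fun _ => 0) (by simpa using h)

lemma abs_expect_le {α : Type*} [Fintype α] [Nonempty α] {F : α → ℝ} {c : ℝ}
    (h : ∀ a, |F a| ≤ c) : |𝔼 a, F a| ≤ c :=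
  (Finset.abs_expect_le _ _).trans <|
    (Finset.expect_le_expect fun a _ => h a).trans (Fintype.expect_const c).le

lemma integrable_of_abs_le {Ω : Type*} [MeasurableSpace Ω] {P : Measure Ω} [IsFiniteMeasure P]
    {f : Ω → ℝ} (hf : Measurable f) {B : ℝ} (hB : ∀ x, |f x| ≤ B) : Integrable f P :=
  Integrable.of_bound hf.aestronglyMeasurable B (Filter.Eventually.of_forall hB)

lemma measurable_expect {α Ω : Type*} [Fintype α] [MeasurableSpace Ω] {f : α → Ω → ℝ}
    (hf : ∀ a, Measurable (f a)) : Measurable fun x => 𝔼 a, f a x := by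
  simp only [Fintype.expect_eq_sum_div_card]
  exact (Finset.measurable_sum _ fun a _ => hf a).div_const _

lemma integral_expect {α Ω : Type*} [Fintype α] [MeasurableSpace Ω] {P : Measure Ω}
    {f : α → Ω → ℝ} (hf : ∀ a, Integrable (f a) P) :
    ∫ x, 𝔼 a, f a x ∂P = 𝔼 a, ∫ x, f a x ∂P := by
  simp only [Fintype.expect_eq_sum_div_card]
  rw [integral_div, integral_finsetSum _ fun a _ => hf a]

lemma integral_comp_measurePreserving {Ω Ω' : Type*} [MeasurableSpace Ω] [MeasurableSpace Ω']
    {P : Measure Ω} {P' : Measure Ω'} {f : Ω → Ω'} (hf : MeasurePreserving f P P') {g : Ω' → ℝ}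
    (hg : Measurable g) : ∫ x, g (f x) ∂P = ∫ y, g y ∂P' := by
  rw [← hf.map_eq, integral_map hf.measurable.aemeasurable hg.aestronglyMeasurable]

lemma abs_integral_le {Ω : Type*} [MeasurableSpace Ω] {P : Measure Ω} [IsProbabilityMeasure P]
    {f : Ω → ℝ} {B : ℝ} (hB : ∀ x, |f x| ≤ B) : |∫ x, f x ∂P| ≤ B := by
  simpa using norm_integral_le_of_norm_le_const (μ := P) (f := f)
    (Filter.Eventually.of_forall hB)

/-! ### McDiarmid's inequality -/

section BoundedDifferences

variable {Z : Type*} [MeasurableSpace Z] (D : Measure Z) [IsProbabilityMeasure D]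

lemma integral_pi_cons {N : ℕ} (g : (Fin (N + 1) → Z) → ℝ) :
    ∫ S, g S ∂Measure.pi (fun _ : Fin (N + 1) => D)
      = ∫ p : Z × (Fin N → Z), g (Fin.cons p.1 p.2)
          ∂D.prod (Measure.pi fun _ : Fin N => D) := by
  have h := (measurePreserving_piFinSuccAbove (fun _ : Fin (N + 1) => D) 0).symm
  rw [← h.integral_comp']
  refine integral_congr_ae (Filter.Eventually.of_forall fun p => ?_)
  simp [MeasurableEquiv.piFinSuccAbove, Fin.insertNthEquiv]

lemma measurable_fin_cons {N : ℕ} :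
    Measurable fun p : Z × (Fin N → Z) => (Fin.cons p.1 p.2 : Fin (N + 1) → Z) := by
  refine measurable_pi_iff.2 fun n => ?_
  refine Fin.cases ?_ (fun k => ?_) n
  · simpa using measurable_fst
  · exact (measurable_pi_apply k).comp measurable_snd

/-- The moment generating function of a function with bounded differences. -/
theorem mgf_bounded_differences_le {N : ℕ} (g : (Fin N → Z) → ℝ) (hg : Measurable g) {c B : ℝ}
    (hB : ∀ S, |g S| ≤ B) (hc : ∀ S n z, |g (Function.update S n z) - g S| ≤ c) (t : ℝ) :
    ∫ S, Real.exp (t * (g S - ∫ S', g S' ∂Measure.pi fun _ => D)) ∂Measure.pi (fun _ => D)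
      ≤ Real.exp (N * c ^ 2 * t ^ 2 / 8) := by
  induction N with
  | zero =>
    have h : ∀ S, g S = g default := fun S => congrArg g (Subsingleton.elim _ _)
    simp [h]
  | succ N ih =>
    obtain ⟨z₀⟩ : Nonempty Z := nonempty_of_isProbabilityMeasure D
    set P := Measure.pi (fun _ : Fin N => D)
    set m := ∫ S', g S' ∂Measure.pi (fun _ : Fin (N + 1) => D) with hm
    have hgc : Measurable fun p : Z × (Fin N → Z) => g (Fin.cons p.1 p.2) :=
      hg.comp measurable_fin_cons
    have hgz : ∀ z, Measurable fun w : Fin N → Z => g (Fin.cons z w) := fun z =>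
      hgc.comp measurable_prodMk_left
    have hgi : ∀ z, Integrable (fun w : Fin N → Z => g (Fin.cons z w)) P := fun z =>
      integrable_of_abs_le (hgz z) fun w => hB _
    -- The conditional mean given the first coordinate. It takes values in an interval of length
    -- `c`, so Hoeffding's lemma controls its exponential moment; given that coordinate, the
    -- fluctuation about `g₁ z` falls to the induction hypothesis.
    set g₁ : Z → ℝ := fun z => ∫ w, g (Fin.cons z w) ∂P with hg₁
    have hg₁m : Measurable g₁ :=
      (StronglyMeasurable.integral_prod_right (f := fun z w => g (Fin.cons z w))
        hgc.stronglyMeasurable).measurable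
    have hg₁B : ∀ z, |g₁ z| ≤ B := fun z => abs_integral_le fun w => hB _
    have hg₁c : ∀ z z', g₁ z ≤ g₁ z' + c := by
      intro z z'
      have : g₁ z ≤ ∫ w, (g (Fin.cons z' w) + c) ∂P := by
        refine integral_mono (hgi z) ((hgi z').add (integrable_const c)) fun w => ?_
        have := (abs_sub_le_iff.1 (hc (Fin.cons z' w) 0 z)).1
        rw [Fin.update_cons_zero] at this
        show g (Fin.cons z w) ≤ g (Fin.cons z' w) + c
        linarith
      rw [integral_add (hgi z') (integrable_const c)] at this
      simpa using this
    have hmg : m = ∫ z, g₁ z ∂D := by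
      rw [hm, integral_pi_cons, integral_prod _ (integrable_of_abs_le hgc fun p => hB _)]
    have hbdd : BddBelow (Set.range g₁) :=
      ⟨-B, by rintro _ ⟨z, rfl⟩; exact (abs_le.1 (hg₁B z)).1⟩
    have hne : Nonempty Z := ⟨z₀⟩
    have hIcc : ∀ z, g₁ z ∈ Set.Icc (⨅ z, g₁ z) ((⨅ z, g₁ z) + c) := fun z =>
      ⟨ciInf_le hbdd z, by
        have : g₁ z - c ≤ ⨅ z, g₁ z := le_ciInf fun z' => by linarith [hg₁c z z']
        linarith⟩
    have hH := (ProbabilityTheory.hasSubgaussianMGF_of_mem_Icc (μ := D) hg₁m.aemeasurable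
      (Filter.Eventually.of_forall hIcc)).mgf_le t
    rw [ProbabilityTheory.mgf, ← hmg] at hH
    have hmB : |m| ≤ B := by
      rw [hmg]
      exact abs_integral_le hg₁B
    have hexpB : ∀ x y : ℝ, |x| ≤ B → |y| ≤ B →
        |Real.exp (t * (x - y))| ≤ Real.exp (|t| * (2 * B)) := by
      intro x y hx hy
      rw [abs_of_pos (Real.exp_pos _), Real.exp_le_exp]
      refine (le_abs_self _).trans ?_
      rw [abs_mul]
      refine mul_le_mul_of_nonneg_left ?_ (abs_nonneg t)
      linarith [abs_sub x y]
    have hi₀ : Integrable (fun p : Z × (Fin N → Z) => Real.exp (t * (g (Fin.cons p.1 p.2) - m)))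
        (D.prod P) :=
      integrable_of_abs_le (Real.measurable_exp.comp ((hgc.sub_const m).const_mul t))
        fun p => hexpB _ _ (hB _) hmB
    rw [integral_pi_cons, integral_prod _ hi₀]
    have hinner : ∀ z, ∫ w, Real.exp (t * (g (Fin.cons z w) - m)) ∂P
        ≤ Real.exp (N * c ^ 2 * t ^ 2 / 8) * Real.exp (t * (g₁ z - m)) := by
      intro z
      have e : ∀ w : Fin N → Z, Real.exp (t * (g (Fin.cons z w) - m))
          = Real.exp (t * (g (Fin.cons z w) - g₁ z)) * Real.exp (t * (g₁ z - m)) := fun w => by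
        rw [← Real.exp_add]; congr 1; ring
      simp only [e]
      rw [integral_mul_const]
      refine mul_le_mul_of_nonneg_right ?_ (Real.exp_pos _).le
      refine ih (fun w => g (Fin.cons z w)) (hgz z) (fun w => hB _) fun S n z' => ?_
      simpa [← Fin.cons_update] using hc (Fin.cons z S) n.succ z'
    have hi₁ : Integrable (fun z => Real.exp (t * (g₁ z - m))) D :=
      integrable_of_abs_le (Real.measurable_exp.comp ((hg₁m.sub_const m).const_mul t))
        fun z => hexpB _ _ (hg₁B z) hmB
    have hi₂ : Integrable (fun z => ∫ w, Real.exp (t * (g (Fin.cons z w) - m)) ∂P) D :=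
      hi₀.integral_prod_left
    refine (integral_mono hi₂ (hi₁.const_mul _) hinner).trans ?_
    rw [integral_const_mul]
    refine (mul_le_mul_of_nonneg_left hH (Real.exp_pos _).le).trans (le_of_eq ?_)
    rw [← Real.exp_add]
    congr 1
    push_cast
    rw [add_sub_cancel_left, div_pow, Real.norm_eq_abs, sq_abs]
    ring

/-- McDiarmid's inequality. -/
theorem measure_bounded_differences_le {N : ℕ} (hN : 1 ≤ N) (g : (Fin N → Z) → ℝ)
    (hg : Measurable g) {c B : ℝ} (hc0 : 0 < c) (hB : ∀ S, |g S| ≤ B)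
    (hc : ∀ S n z, |g (Function.update S n z) - g S| ≤ c) {δ : ℝ} (hδ0 : 0 < δ) (hδ1 : δ < 1) :
    Measure.pi (fun _ : Fin N => D)
      {S | (∫ S', g S' ∂Measure.pi fun _ => D) + c * √(N * Real.log (1 / δ) / 2) < g S}
      ≤ ENNReal.ofReal δ := by
  set P := Measure.pi (fun _ : Fin N => D)
  set m := ∫ S', g S' ∂P with hm
  have hmB : |m| ≤ B := abs_integral_le hB
  have hsub : ProbabilityTheory.HasSubgaussianMGF (fun S => g S - m)
      (N * (c.toNNReal / 2) ^ 2) P := by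
    refine ⟨fun t => ?_, fun t => ?_⟩
    · refine integrable_of_abs_le (B := Real.exp (|t| * (2 * B)))
        (Real.measurable_exp.comp ((hg.sub_const m).const_mul t)) fun S => ?_
      rw [abs_of_pos (Real.exp_pos _), Real.exp_le_exp]
      refine (le_abs_self _).trans ?_
      rw [abs_mul]
      refine mul_le_mul_of_nonneg_left ?_ (abs_nonneg t)
      linarith [abs_sub (g S) m, hB S]
    · refine (mgf_bounded_differences_le D g hg hB hc t).trans (le_of_eq ?_)
      congr 1
      push_cast
      rw [Real.coe_toNNReal _ hc0.le]
      ring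
  have hN0 : (0 : ℝ) < N := by exact_mod_cast hN
  have hlog : 0 ≤ Real.log (1 / δ) := Real.log_nonneg (by rw [le_div_iff₀ hδ0]; linarith)
  have h := hsub.measure_ge_le (ε := c * √(N * Real.log (1 / δ) / 2)) (by positivity)
  -- The deviation is chosen to make the Chernoff exponent for variance proxy Nc²/4 equal to log δ.
  have e : -(c * √(N * Real.log (1 / δ) / 2)) ^ 2
      / (2 * ((N * (c.toNNReal / 2) ^ 2 : NNReal) : ℝ)) = Real.log δ := by
    push_cast
    rw [Real.coe_toNNReal _ hc0.le, mul_pow, Real.sq_sqrt (by positivity), one_div,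
      Real.log_inv]
    field_simp
  rw [e, Real.exp_log hδ0] at h
  refine (measure_mono fun S hS => ?_).trans
    (ENNReal.le_ofReal_iff_toReal_le (measure_ne_top _ _) hδ0.le |>.2 h)
  simp only [Set.mem_ofPred_eq] at hS ⊢
  linarith

end BoundedDifferences

/-! ### Symmetrization and uniform deviations -/

section Rademacher

variable {Z ι : Type*}

/-- The (unnormalized) empirical Rademacher average of the family `h` on the sample `S`. -/
noncomputable def rademacher {N : ℕ} (h : ι → Z → ℝ) (S : Fin N → Z) : ℝ :=
  𝔼 ε : Fin N → Bool, ⨆ i, ∑ n, sgn (ε n) * h i (S n)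

lemma sum_update_sub {N : ℕ} (F : Fin N → Z → ℝ) (S : Fin N → Z) (n : Fin N) (z : Z) :
    ∑ k, F k (Function.update S n z k) - ∑ k, F k (S k) = F n z - F n (S n) := by
  rw [← Finset.sum_sub_distrib, Finset.sum_eq_single n]
  · simp
  · intro k _ hk
    simp [hk]
  · simp

lemma abs_sgn_mul_le {x B : ℝ} (b : Bool) (h0 : 0 ≤ x) (h1 : x ≤ B) : |sgn b * x| ≤ B := by
  rw [abs_mul, abs_sgn, one_mul, abs_of_nonneg h0]
  exact h1

lemma measurable_iSup_sum {Ω : Type*} [Finite ι] [MeasurableSpace Ω] {N : ℕ}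
    {F : ι → Fin N → Ω → ℝ} (hF : ∀ i n, Measurable (F i n)) :
    Measurable fun x => ⨆ i, ∑ n, F i n x :=
  Measurable.iSup fun i => Finset.measurable_sum _ fun n _ => hF i n

lemma measurable_rademacher [Finite ι] [MeasurableSpace Z] {N : ℕ} {h : ι → Z → ℝ}
    (hm : ∀ i, Measurable (h i)) : Measurable fun S : Fin N → Z => rademacher h S :=
  measurable_expect fun _ => measurable_iSup_sum fun i n =>
    ((hm i).comp (measurable_pi_apply n)).const_mul _

variable [Finite ι] [Nonempty ι]

lemma abs_iSup_sum_le {N : ℕ} {F : ι → Fin N → ℝ} {B : ℝ} (hF : ∀ i n, |F i n| ≤ B) :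
    |⨆ i, ∑ n, F i n| ≤ N * B := by
  refine abs_iSup_le_of_abs_le fun i => (Finset.abs_sum_le_sum_abs _ _).trans ?_
  exact (Finset.sum_le_sum fun n _ => hF i n).trans (by simp)

lemma abs_rademacher_le {N : ℕ} {h : ι → Z → ℝ} {B : ℝ} (h0 : ∀ i z, 0 ≤ h i z)
    (h1 : ∀ i z, h i z ≤ B) (S : Fin N → Z) : |rademacher h S| ≤ N * B :=
  abs_expect_le fun _ => abs_iSup_sum_le fun i _ => abs_sgn_mul_le _ (h0 i _) (h1 i _)

/-- The changed summand keeps its sign ε_n, so only the difference of two values in [0, B] matters;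
this gives `B` instead of 2`B`. -/
lemma abs_rademacher_update_sub_le {N : ℕ} {h : ι → Z → ℝ} {B : ℝ} (h0 : ∀ i z, 0 ≤ h i z)
    (h1 : ∀ i z, h i z ≤ B) (S : Fin N → Z) (n : Fin N) (z : Z) :
    |rademacher h (Function.update S n z) - rademacher h S| ≤ B := by
  rw [rademacher, rademacher, ← Finset.expect_sub_distrib]
  refine abs_expect_le fun ε => abs_iSup_sub_iSup_le fun i => ?_
  rw [sum_update_sub (fun k z => sgn (ε k) * h i z), ← mul_sub, abs_mul, abs_sgn, one_mul,
    abs_sub_le_iff]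
  constructor <;> linarith [h0 i z, h1 i z, h0 i (S n), h1 i (S n)]

variable [MeasurableSpace Z]

variable (D : Measure Z) [IsProbabilityMeasure D]

/-- Symmetrization. -/
theorem integral_iSup_deviation_le {N : ℕ} {h : ι → Z → ℝ} (hm : ∀ i, Measurable (h i)) {B : ℝ}
    (h0 : ∀ i z, 0 ≤ h i z) (h1 : ∀ i z, h i z ≤ B) :
    ∫ S : Fin N → Z, (⨆ i, ∑ n, ((∫ z, h i z ∂D) - h i (S n))) ∂Measure.pi (fun _ => D)
      ≤ 2 * ∫ S : Fin N → Z, rademacher h S ∂Measure.pi fun _ => D := by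
  set P := Measure.pi (fun _ : Fin N => D)
  have hhi : ∀ i, Integrable (h i) D := fun i => integrable_of_abs_le (hm i) fun z => by
    rw [abs_of_nonneg (h0 i z)]; exact h1 i z
  have hdiff : ∀ i z z', |h i z' - h i z| ≤ B := fun i z z' => by
    rw [abs_sub_le_iff]; constructor <;> linarith [h0 i z, h1 i z, h0 i z', h1 i z']
  -- The second component is a ghost sample whose mean replaces the true risk; the supremum of means
  -- is at most the mean of suprema.
  set Q : (Fin N → Z) × (Fin N → Z) → ℝ := fun p => ⨆ i, ∑ n, (h i (p.2 n) - h i (p.1 n))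
    with hQ
  have hQm : Measurable Q := measurable_iSup_sum fun i n =>
    ((hm i).comp ((measurable_pi_apply n).comp measurable_snd)).sub
      ((hm i).comp ((measurable_pi_apply n).comp measurable_fst))
  have hQB : ∀ p, |Q p| ≤ N * B := fun p => abs_iSup_sum_le fun i n => hdiff _ _ _
  have hQi : Integrable Q (P.prod P) := integrable_of_abs_le hQm hQB
  have hI : ∀ i, |∫ z, h i z ∂D| ≤ B := fun i => abs_integral_le fun z => by
    rw [abs_of_nonneg (h0 i z)]; exact h1 i z
  have hUQ : ∫ S : Fin N → Z, (⨆ i, ∑ n, ((∫ z, h i z ∂D) - h i (S n))) ∂P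
      ≤ ∫ p, Q p ∂P.prod P := by
    rw [integral_prod _ hQi]
    refine integral_mono ?_ hQi.integral_prod_left fun S => ?_
    · refine integrable_of_abs_le (B := N * (B + B))
        (measurable_iSup_sum fun i n => ((hm i).comp (measurable_pi_apply n)).const_sub _)
        fun S => abs_iSup_sum_le fun i n => ?_
      refine (abs_sub _ _).trans (add_le_add (hI i) ?_)
      rw [abs_of_nonneg (h0 i _)]; exact h1 i _
    · refine ciSup_le fun i => ?_
      have hev : ∀ n : Fin N, ∫ S' : Fin N → Z, h i (S' n) ∂P = ∫ z, h i z ∂D := fun n =>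
        integral_comp_measurePreserving (measurePreserving_eval (fun _ : Fin N => D) n) (hm i)
      have hevi : ∀ n : Fin N, Integrable (fun S' : Fin N → Z => h i (S' n)) P := fun n =>
        (measurePreserving_eval (fun _ : Fin N => D) n).integrable_comp_of_integrable (hhi i)
      have e : ∑ n, ((∫ z, h i z ∂D) - h i (S n))
          = ∫ S' : Fin N → Z, ∑ n, (h i (S' n) - h i (S n)) ∂P := by
        have hi' : ∀ n ∈ Finset.univ, Integrable (fun S' : Fin N → Z => h i (S' n) - h i (S n)) P :=
          fun n _ => (hevi n).sub (integrable_const _)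
        rw [integral_finsetSum _ hi']
        refine Finset.sum_congr rfl fun n _ => ?_
        rw [integral_sub (hevi n) (integrable_const _), hev]
        simp
      rw [e]
      refine integral_mono (integrable_finsetSum _ fun n _ => (hevi n).sub (integrable_const _))
        ?_ fun S' => le_iSup_fintype (fun i => ∑ n, (h i (S' n) - h i (S n))) i
      exact integrable_of_abs_le (hQm.comp measurable_prodMk_left) fun S' => hQB (S, S')
  refine hUQ.trans ?_
  have hpair := measurePreserving_arrowProdEquivProdArrow Z Z (Fin N) (fun _ => D) fun _ => D
  have hfst := (measurePreserving_fst (μ := P) (ν := P)).comp hpair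
  have hsnd := (measurePreserving_snd (μ := P) (ν := P)).comp hpair
  rw [← hpair.integral_comp']
  set P₂ := Measure.pi (fun _ : Fin N => D.prod D)
  set A : (Fin N → Bool) → (Fin N → Z) → ℝ := fun ε S => ⨆ i, ∑ n, sgn (ε n) * h i (S n)
    with hA
  have hAm : ∀ ε, Measurable (A ε) := fun ε => measurable_iSup_sum fun i n =>
    ((hm i).comp (measurable_pi_apply n)).const_mul _
  have hAi : ∀ ε, Integrable (A ε) P := fun ε => integrable_of_abs_le (hAm ε) fun S =>
    abs_iSup_sum_le fun i n => abs_sgn_mul_le _ (h0 i _) (h1 i _)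
  -- Swapping the pair (w n).1, (w n).2 wherever `ε n` is false preserves the law and multiplies the
  -- n-th difference by its sign. The supremum then splits into one signed supremum per sample, with
  -- opposite signs; averaging over ε makes the two equal.
  have hε : ∀ ε : Fin N → Bool,
      ∫ w, Q (MeasurableEquiv.arrowProdEquivProdArrow Z Z (Fin N) w) ∂P₂
        ≤ (∫ S, A ε S ∂P) + ∫ S, A (fun n => !ε n) S ∂P := by
    intro ε
    have hswap : MeasurePreserving
        (fun (w : Fin N → Z × Z) n => (if ε n then id else Prod.swap) (w n)) P₂ P₂ := by
      refine measurePreserving_pi (fun _ : Fin N => D.prod D) (fun _ => D.prod D)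
        (f := fun n => if ε n then id else Prod.swap) fun n => ?_
      by_cases hn : ε n = true
      · simpa [hn] using MeasurePreserving.id (D.prod D)
      · simpa [hn] using Measure.measurePreserving_swap (μ := D) (ν := D)
    set e := MeasurableEquiv.arrowProdEquivProdArrow Z Z (Fin N) with he
    have hi₁ : Integrable (fun w => A ε ((Prod.snd ∘ e) w)) P₂ :=
      hsnd.integrable_comp_of_integrable (hAi ε)
    have hi₂ : Integrable (fun w => A (fun n => !ε n) ((Prod.fst ∘ e) w)) P₂ :=
      hfst.integrable_comp_of_integrable (hAi _)
    have hQp : Measurable fun w => Q (e w) :=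
      hQm.comp hpair.measurable
    rw [← integral_comp_measurePreserving hswap hQp,
      ← integral_comp_measurePreserving hsnd (hAm ε),
      ← integral_comp_measurePreserving hfst (hAm _),
      ← integral_add hi₁ hi₂]
    refine integral_mono (integrable_of_abs_le (hQp.comp hswap.measurable)
      fun w => hQB _) (hi₁.add hi₂) fun w => ?_
    refine ciSup_le fun i => ?_
    have a1 := le_iSup_fintype (fun i => ∑ n, sgn (ε n) * h i (w n).2) i
    have a2 := le_iSup_fintype (fun i => ∑ n, sgn (!ε n) * h i (w n).1) i
    refine le_trans (le_of_eq ?_) (add_le_add a1 a2)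
    rw [← Finset.sum_add_distrib]
    refine Finset.sum_congr rfl fun n _ => ?_
    by_cases hn : ε n = true
    · simp [he, hn, sgn, MeasurableEquiv.arrowProdEquivProdArrow, Equiv.arrowProdEquivProdArrow]
      ring
    · simp [he, hn, sgn, MeasurableEquiv.arrowProdEquivProdArrow, Equiv.arrowProdEquivProdArrow]
      ring
  have havg := Finset.expect_le_expect (s := Finset.univ) fun ε _ => hε ε
  rw [Fintype.expect_const, Finset.expect_add_distrib,
    expect_flip fun ε => ∫ S, A ε S ∂P, ← integral_expect hAi] at havg
  simp only [rademacher]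
  linarith

/-- Uniform deviation bounds for finite families, in terms of the empirical and of the expected
Rademacher averages. -/
theorem measure_deviation_le {N : ℕ} (hN : 1 ≤ N) {h : ι → Z → ℝ} (hm : ∀ i, Measurable (h i))
    {B : ℝ} (h0 : ∀ i z, 0 ≤ h i z) (h1 : ∀ i z, h i z ≤ B) {δ : ℝ} (hδ0 : 0 < δ)
    (hδ1 : δ < 1) :
    Measure.pi (fun _ : Fin N => D)
      {S | ¬ ((∀ i, ∑ n, ((∫ z, h i z ∂D) - h i (S n))
            ≤ 2 * rademacher h S + 3 * B * √(N * Real.log (2 / δ) / 2)) ∧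
          ∀ i, ∑ n, ((∫ z, h i z ∂D) - h i (S n))
            ≤ 2 * (∫ S' : Fin N → Z, rademacher h S' ∂Measure.pi fun _ => D)
              + 3 * B * √(N * Real.log (2 / δ) / 2))} ≤ ENNReal.ofReal δ := by
  set P := Measure.pi (fun _ : Fin N => D) with hP
  obtain ⟨z₀⟩ : Nonempty Z := nonempty_of_isProbabilityMeasure D
  have hB0 : 0 ≤ B := (h0 (Classical.arbitrary ι) z₀).trans (h1 _ _)
  -- McDiarmid needs a positive increment bound; for `B` = 0 all functions vanish.
  rcases hB0.eq_or_lt with rfl | hB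
  · have hz : ∀ i z, h i z = 0 := fun i z => le_antisymm (h1 i z) (h0 i z)
    simp [hz, rademacher]
  set U : (Fin N → Z) → ℝ := fun S => ⨆ i, ∑ n, ((∫ z, h i z ∂D) - h i (S n)) with hU
  have hI : ∀ i, |∫ z, h i z ∂D| ≤ B := fun i => abs_integral_le fun z => by
    rw [abs_of_nonneg (h0 i z)]; exact h1 i z
  have hUm : Measurable U :=
    measurable_iSup_sum fun i n => ((hm i).comp (measurable_pi_apply n)).const_sub _
  have hUB : ∀ S, |U S| ≤ N * (B + B) := fun S => abs_iSup_sum_le fun i n => by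
    refine (abs_sub _ _).trans (add_le_add (hI i) ?_)
    rw [abs_of_nonneg (h0 i _)]; exact h1 i _
  have hUc : ∀ S n z, |U (Function.update S n z) - U S| ≤ B := fun S n z =>
    abs_iSup_sub_iSup_le fun i => by
      rw [sum_update_sub (fun _ z' => (∫ z, h i z ∂D) - h i z') S n z, abs_sub_le_iff]
      constructor <;> linarith [h0 i z, h1 i z, h0 i (S n), h1 i (S n)]
  have hδ2 : (0 : ℝ) < δ / 2 := by linarith
  have hδ3 : δ / 2 < 1 := by linarith
  have b1 := measure_bounded_differences_le D hN U hUm hB hUB hUc hδ2 hδ3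
  have b2 := measure_bounded_differences_le D hN (fun S => -rademacher h S)
    (measurable_rademacher hm).neg hB (fun S => by
      rw [abs_neg]; exact abs_rademacher_le h0 h1 S) (fun S n z => by
      rw [neg_sub_neg, abs_sub_comm]; exact abs_rademacher_update_sub_le h0 h1 S n z) hδ2 hδ3
  have hsym := integral_iSup_deviation_le D (N := N) hm h0 h1
  rw [integral_neg] at b2
  rw [show (1 : ℝ) / (δ / 2) = 2 / δ by field_simp] at b1 b2
  have hsplit : ENNReal.ofReal δ = ENNReal.ofReal (δ / 2) + ENNReal.ofReal (δ / 2) := by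
    rw [← ENNReal.ofReal_add hδ2.le hδ2.le, add_halves]
  rw [hsplit]
  -- Each exceptional event costs δ/2. Concentration of `U` uses one unit of the confidence term;
  -- passing from the expected to the empirical Rademacher average, which enters twice, uses two
  -- more.
  refine (measure_mono fun S hS => ?_).trans ((measure_union_le _ _).trans (add_le_add b1 b2))
  by_contra hcon
  simp only [Set.mem_union, Set.mem_ofPred_eq, not_or, not_lt] at hcon
  have hr : 0 ≤ B * √(N * Real.log (2 / δ) / 2) := by positivity
  have hle : ∀ i, ∑ n, ((∫ z, h i z ∂D) - h i (S n)) ≤ U S := fun i =>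
    le_iSup_fintype (fun i => ∑ n, ((∫ z, h i z ∂D) - h i (S n))) i
  refine hS ⟨fun i => ?_, fun i => ?_⟩ <;> linarith [hle i, hcon.1, hcon.2]

end Rademacher

/-! ### Bounds and Lipschitz constants of the surrogate loss -/

/-- Sorting does not increase the Euclidean distance. -/
lemma sum_topEntry_sub_sq_le {C : ℕ} (s s' : Fin C → ℝ) :
    ∑ k, (topEntry s k - topEntry s' k) ^ 2 ≤ ∑ j, (s j - s' j) ^ 2 := by
  set σ := Tuple.sort s
  set σ' := Tuple.sort s'
  have e1 : ∀ F : Fin C → ℝ, ∑ k, F (σ (Fin.rev k)) = ∑ j, F j := fun F =>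
    Equiv.sum_comp (Fin.revPerm.trans σ) F
  have e2 : ∀ F : Fin C → ℝ, ∑ k, F (σ' (Fin.rev k)) = ∑ j, F j := fun F =>
    Equiv.sum_comp (Fin.revPerm.trans σ') F
  -- Sorting both vectors preserves their norms and, by the rearrangement inequality, can only
  -- increase their inner product.
  have hmono : Monovary (s' ∘ σ') (s ∘ σ) :=
    (Tuple.monotone_sort s').monovary (Tuple.monotone_sort s)
  have hr := hmono.sum_comp_perm_mul_le_sum_mul (σ := σ.trans σ'.symm)
  have hl : ∑ k, (s' ∘ σ') ((σ.trans σ'.symm) k) * (s ∘ σ) k = ∑ j, s' j * s j := by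
    rw [← Equiv.sum_comp σ fun j => s' j * s j]
    simp
  have hm : ∑ k, (s' ∘ σ') k * (s ∘ σ) k = ∑ k, topEntry s' k * topEntry s k :=
    (Equiv.sum_comp Fin.revPerm fun k => (s' ∘ σ') k * (s ∘ σ) k).symm
  rw [hl, hm] at hr
  have a1 : ∑ k, topEntry s k ^ 2 = ∑ j, s j ^ 2 := e1 fun j => s j ^ 2
  have a2 : ∑ k, topEntry s' k ^ 2 = ∑ j, s' j ^ 2 := e2 fun j => s' j ^ 2
  have expand : ∀ u v : Fin C → ℝ,
      ∑ k, (u k - v k) ^ 2 = ∑ k, u k ^ 2 - 2 * ∑ k, v k * u k + ∑ k, v k ^ 2 := fun u v => by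
    rw [Finset.mul_sum, ← Finset.sum_sub_distrib, ← Finset.sum_add_distrib]
    exact Finset.sum_congr rfl fun k _ => by ring
  rw [expand, expand, a1, a2]
  linarith

lemma abs_le_sqrt_sum_sq {C : ℕ} (d : Fin C → ℝ) (k : Fin C) : |d k| ≤ √(∑ j, d j ^ 2) :=
  Real.abs_le_sqrt (Finset.single_le_sum (f := fun j => d j ^ 2) (fun _ _ => sq_nonneg _)
    (Finset.mem_univ k))

lemma abs_topEntry_sub_le {C : ℕ} (s s' : Fin C → ℝ) (k : Fin C) :
    |topEntry s k - topEntry s' k| ≤ √(∑ j, (s j - s' j) ^ 2) :=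
  (abs_le_sqrt_sum_sq (fun k => topEntry s k - topEntry s' k) k).trans
    (Real.sqrt_le_sqrt (sum_topEntry_sub_sq_le s s'))

lemma card_top_le (C K : ℕ) :
    ((Finset.univ.filter fun k : Fin C => (k : ℕ) < K + 1).card : ℝ) ≤ K + 1 := by
  have : (Finset.univ.filter fun k : Fin C => (k : ℕ) < K + 1).card
      ≤ (Finset.range (K + 1)).card :=
    Finset.card_le_card_of_injOn (fun k => (k : ℕ)) (fun k hk => by simpa using hk)
      fun a _ b _ h => Fin.ext h
  rw [Finset.card_range] at this
  exact_mod_cast this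

/-- Up to an absolute constant, the Lipschitz constant of the surrogate loss at a label vector
with `q` relevant labels. -/
noncomputable def Weighting.lipWeight (a : Weighting) (K q : ℕ) : ℝ :=
  if q ∈ Finset.Icc 1 K then
    match a with
    | .one => q
    | .two => 1
    | .three => 1 / K
  else 0

lemma Weighting.lipWeight_nonneg (a : Weighting) (K q : ℕ) : 0 ≤ a.lipWeight K q := by
  unfold lipWeight
  split_ifs
  · cases a <;> simp
  · exact le_rfl

/-- This is 2K + 1 - q ≥ K + 1. The factor K + 1 cancels the number of ranking positions, which is
what gains 1/K for the third weighting. -/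
lemma Weighting.alpha_three_ge {K q : ℕ} (hq : q ≤ K) :
    (q : ℝ) * (K + 1) / 2 ≤ Weighting.three.alpha K q := by
  have h : (q : ℝ) ≤ K := by exact_mod_cast hq
  have h0 : (0 : ℝ) ≤ q := q.cast_nonneg
  simp only [alpha, min_eq_right hq]
  nlinarith

lemma Weighting.alpha_pos (a : Weighting) {K q : ℕ} (hq1 : 1 ≤ q) (hq : q ≤ K) :
    0 < a.alpha K q := by
  have h1 : (1 : ℝ) ≤ q := by exact_mod_cast hq1
  cases a
  · simp [alpha]
  · simp only [alpha, min_eq_right hq]; linarith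
  · exact lt_of_lt_of_le (by positivity) (alpha_three_ge hq)

/-- The left side bounds the number of terms in the double sum of the loss, and αK is its
normalization. The factor 2 covers K + 1 ≤ 2K and the half in α₃. -/
lemma Weighting.mul_le_lipWeight (a : Weighting) {K q : ℕ} (hq1 : 1 ≤ q) (hq : q ≤ K) :
    (q : ℝ) * (K + 1) ≤ 2 * a.lipWeight K q * (a.alpha K q * K) := by
  have h1 : (1 : ℝ) ≤ q := by exact_mod_cast hq1
  have hK : (1 : ℝ) ≤ K := by exact_mod_cast hq1.trans hq
  cases a
  · simp only [lipWeight, Finset.mem_Icc, hq1, hq, and_self, if_true, alpha]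
    nlinarith
  · simp only [lipWeight, Finset.mem_Icc, hq1, hq, and_self, if_true, alpha, min_eq_right hq]
    nlinarith
  · have h := alpha_three_ge hq
    simp only [lipWeight, Finset.mem_Icc, hq1, hq, and_self, if_true]
    generalize Weighting.three.alpha K q = α at h
    field_simp
    linarith

lemma Weighting.mul_le_lossBound (a : Weighting) {K q : ℕ} (hq1 : 1 ≤ q) (hq : q ≤ K) {M : ℝ}
    (hM : 0 ≤ M) : (q : ℝ) * (K + 1) * M ≤ a.lossBound K M * (a.alpha K q * K) := by
  have h1 : (1 : ℝ) ≤ q := by exact_mod_cast hq1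
  have hqK : (q : ℝ) ≤ K := by exact_mod_cast hq
  have hK : (1 : ℝ) ≤ K := h1.trans hqK
  have hM' : 0 ≤ (K + 1 : ℝ) * M := by positivity
  cases a
  · simp only [lossBound, alpha]
    nlinarith
  · simp only [lossBound, alpha, min_eq_right hq]
    nlinarith [mul_nonneg hM' (by linarith : (0 : ℝ) ≤ q)]
  · have h := alpha_three_ge hq
    simp only [lossBound]
    generalize Weighting.three.alpha K q = α at h
    have : (q : ℝ) ≤ α := by nlinarith
    rw [show ((K : ℝ) + 1) / K * M * (α * K) = ((K : ℝ) + 1) * M * α by field_simp]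
    nlinarith

lemma Weighting.lossBound_nonneg (a : Weighting) (K : ℕ) {M : ℝ} (hM : 0 ≤ M) :
    0 ≤ a.lossBound K M := by
  cases a <;> simp only [lossBound] <;> positivity

/-- The surrogate loss, cut off at label vectors with more than `K` relevant labels. -/
noncomputable def truncLoss {C : ℕ} (a : Weighting) (K : ℕ) (g : ℝ → ℝ) (s : Fin C → ℝ)
    (y : Label C) : ℝ :=
  if numRelevant y ∈ Finset.Icc 1 K then surrogateLoss a K g s y else 0

/-- At q = 0 both sides vanish because the sum is empty. So the cut-off changes the loss only on a
null set, while making its bounds valid everywhere, as the bounded-difference arguments require. -/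
lemma truncLoss_eq {C : ℕ} (a : Weighting) {K : ℕ} (g : ℝ → ℝ) (s : Fin C → ℝ) {y : Label C}
    (hy : numRelevant y ≤ K) : truncLoss a K g s y = surrogateLoss a K g s y := by
  unfold truncLoss
  split_ifs with h
  · rfl
  · have h0 : numRelevant y = 0 := by
      rw [Finset.mem_Icc] at h
      omega
    have : relevant y = ∅ := Finset.card_eq_zero.1 h0
    simp [surrogateLoss, this]

lemma truncLoss_nonneg {C : ℕ} (a : Weighting) (K : ℕ) {g : ℝ → ℝ} (hg : ∀ t, 0 ≤ g t)
    (s : Fin C → ℝ) (y : Label C) : 0 ≤ truncLoss a K g s y := by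
  unfold truncLoss
  split_ifs with h
  · rw [Finset.mem_Icc] at h
    have := a.alpha_pos h.1 h.2
    exact mul_nonneg (by positivity)
      (Finset.sum_nonneg fun _ _ => Finset.sum_nonneg fun _ _ => hg _)
  · exact le_rfl

lemma truncLoss_le {C : ℕ} (a : Weighting) (K : ℕ) {g : ℝ → ℝ} {M : ℝ} (hM : 0 ≤ M)
    (hg : ∀ t, g t ≤ M) (s : Fin C → ℝ) (y : Label C) :
    truncLoss a K g s y ≤ a.lossBound K M := by
  unfold truncLoss
  split_ifs with h
  · rw [Finset.mem_Icc] at h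
    have hα := a.alpha_pos h.1 h.2
    have hK : (0 : ℝ) < K := by exact_mod_cast h.1.trans h.2
    rw [surrogateLoss, one_div, inv_mul_le_iff₀ (by positivity), mul_comm]
    refine le_trans ?_ (a.mul_le_lossBound h.1 h.2 hM)
    calc _ ≤ ∑ _i ∈ relevant y, ((K : ℝ) + 1) * M := by
          refine Finset.sum_le_sum fun i _ => ?_
          refine (Finset.sum_le_sum fun k _ => hg _).trans ?_
          rw [Finset.sum_const, nsmul_eq_mul]
          exact mul_le_mul_of_nonneg_right (card_top_le C K) hM
      _ = _ := by rw [Finset.sum_const, nsmul_eq_mul, numRelevant, mul_assoc]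
  · exact a.lossBound_nonneg K hM

/-- A score and an order statistic are each 1-Lipschitz in the Euclidean norm, so every term moves
by at most 2μd; `Weighting.mul_le_lipWeight` contributes the other factor 2. -/
lemma abs_truncLoss_sub_le {C : ℕ} (a : Weighting) (K : ℕ) {g : ℝ → ℝ} {μ : NNReal}
    (hg : LipschitzWith μ g) (s s' : Fin C → ℝ) (y : Label C) :
    |truncLoss a K g s y - truncLoss a K g s' y|
      ≤ 4 * μ * a.lipWeight K (numRelevant y) * √(∑ j, (s j - s' j) ^ 2) := by
  set d := √(∑ j, (s j - s' j) ^ 2) with hd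
  have hd0 : 0 ≤ d := Real.sqrt_nonneg _
  unfold truncLoss
  split_ifs with h
  · rw [Finset.mem_Icc] at h
    have hα := a.alpha_pos h.1 h.2
    have hK : (0 : ℝ) < K := by exact_mod_cast h.1.trans h.2
    rw [surrogateLoss, surrogateLoss, ← mul_sub, abs_mul, abs_of_nonneg (by positivity), one_div,
      inv_mul_le_iff₀ (by positivity)]
    have hterm : ∀ i k, |g (s i - topEntry s k) - g (s' i - topEntry s' k)| ≤ μ * (2 * d) := by
      intro i k
      have h1 := hg.dist_le_mul (s i - topEntry s k) (s' i - topEntry s' k)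
      rw [Real.dist_eq, Real.dist_eq] at h1
      refine h1.trans (mul_le_mul_of_nonneg_left ?_ μ.coe_nonneg)
      have h2 := abs_le_sqrt_sum_sq (fun j => s j - s' j) i
      have h3 := abs_topEntry_sub_le s s' k
      have h4 := abs_sub (s i - s' i) (topEntry s k - topEntry s' k)
      rw [sub_sub_sub_comm]
      linarith
    rw [← Finset.sum_sub_distrib]
    calc _ ≤ ∑ _i ∈ relevant y, ((K : ℝ) + 1) * (μ * (2 * d)) := by
          refine (Finset.abs_sum_le_sum_abs _ _).trans (Finset.sum_le_sum fun i _ => ?_)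
          rw [← Finset.sum_sub_distrib]
          refine (Finset.abs_sum_le_sum_abs _ _).trans ?_
          refine (Finset.sum_le_sum fun k _ => hterm i k).trans ?_
          rw [Finset.sum_const, nsmul_eq_mul]
          exact mul_le_mul_of_nonneg_right (card_top_le C K) (by positivity)
      _ = ((numRelevant y : ℝ) * (K + 1)) * (μ * (2 * d)) := by
          rw [Finset.sum_const, nsmul_eq_mul, numRelevant, mul_assoc]
      _ ≤ _ := mul_le_mul_of_nonneg_right (a.mul_le_lipWeight h.1 h.2) (by positivity)
      _ = _ := by ring
  · rw [sub_zero, abs_zero]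
    have := a.lipWeight_nonneg K (numRelevant y)
    positivity

lemma continuous_truncLoss {C : ℕ} (a : Weighting) (K : ℕ) {g : ℝ → ℝ} {μ : NNReal}
    (hg : LipschitzWith μ g) (y : Label C) : Continuous fun s => truncLoss a K g s y := by
  rw [continuous_iff_continuousAt]
  intro s
  rw [ContinuousAt, tendsto_iff_dist_tendsto_zero]
  have hc : Continuous fun s' : Fin C → ℝ =>
      4 * μ * a.lipWeight K (numRelevant y) * √(∑ j, (s' j - s j) ^ 2) := by fun_prop
  refine squeeze_zero (fun _ => dist_nonneg) (fun s' => ?_) (by simpa using hc.tendsto s)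
  rw [Real.dist_eq]
  exact abs_truncLoss_sub_le a K hg s' s y

/-! ### Exponential sums and the rates -/

/-- The dependence of the squared complexity term on `K` and on the exponent `lam`. -/
noncomputable def Weighting.rateFactor (a : Weighting) (K : ℕ) (lam : ℝ) : ℝ :=
  match a with
  | .one => 1 / lam ^ 4
  | .two => 1 / Real.exp lam
  | .three => 1 / ((K : ℝ) ^ 2 * Real.exp lam)

lemma Weighting.rate_eq (a : Weighting) (C N K : ℕ) (Λ r lam : ℝ) :
    a.rate C N K Λ r lam = √(C * Λ ^ 2 * r ^ 2 / N * a.rateFactor K lam) := by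
  cases a <;> simp only [rate, rateFactor, div_mul_div_comm, mul_one, mul_assoc]

lemma sum_inv_sq_le (K : ℕ) : ∑ q ∈ Finset.Icc 1 K, ((q : ℝ) ^ 2)⁻¹ ≤ 2 := by
  have h := sum_Ioo_inv_sq_le (α := ℝ) 0 (K + 1)
  have e : Finset.Ioo 0 (K + 1) = Finset.Icc 1 K := by
    ext q
    simp only [Finset.mem_Ioo, Finset.mem_Icc]
    omega
  rw [e] at h
  simpa using h

/-- From e^x ≥ x⁴/24 at x = λq, each term is at most 24/(λ⁴q²), which is summable uniformly in `K`.
-/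
lemma sum_exp_mul_sq_le (K : ℕ) {lam : ℝ} (hl : 0 < lam) :
    ∑ q ∈ Finset.Icc 1 K, Real.exp (-(lam * (q : ℝ))) * (q : ℝ) ^ 2 ≤ 48 / lam ^ 4 := by
  have h : ∀ q ∈ Finset.Icc 1 K, Real.exp (-(lam * (q : ℝ))) * (q : ℝ) ^ 2
      ≤ 24 / lam ^ 4 * ((q : ℝ) ^ 2)⁻¹ := by
    intro q hq
    have hq1 : (0 : ℝ) < q := by exact_mod_cast (Finset.mem_Icc.1 hq).1
    have := Real.pow_div_factorial_le_exp (lam * q) (by positivity) 4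
    norm_num [Nat.factorial] at this
    rw [Real.exp_neg, inv_mul_le_iff₀ (Real.exp_pos _)]
    refine le_trans (le_of_eq ?_) (mul_le_mul_of_nonneg_right this (by positivity))
    field_simp
  refine (Finset.sum_le_sum h).trans ?_
  rw [← Finset.mul_sum]
  refine (mul_le_mul_of_nonneg_left (sum_inv_sq_le K) (by positivity)).trans (le_of_eq ?_)
  ring

/-- For λ ≤ 1 the normalization suffices, as e^λ ≤ 3; this case produces the 1 in 1 + c. For λ ≥ 1,
λ(q - 1) ≥ q - 1 bounds e^{-λq}e^λ by e·e^{-q}, whose sum over q is bounded, giving a multiple of c.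
-/
lemma mul_sum_exp_le (K : ℕ) {lam c : ℝ} (hc : 0 < c)
    (hsum : c * ∑ q ∈ Finset.Icc 1 K, Real.exp (-(lam * (q : ℝ))) ≤ 1) :
    c * ∑ q ∈ Finset.Icc 1 K, Real.exp (-(lam * (q : ℝ))) ≤ 48 * (1 + c) / Real.exp lam := by
  have he : Real.exp 1 ≤ 3 := by linarith [Real.exp_one_lt_d9]
  rw [le_div_iff₀ (Real.exp_pos _)]
  rcases le_total lam 1 with h1 | h1
  · have h3 : Real.exp lam ≤ 3 := (Real.exp_le_exp.2 h1).trans he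
    have := mul_le_mul hsum h3 (Real.exp_pos _).le zero_le_one
    linarith
  · have h : ∀ q ∈ Finset.Icc 1 K, Real.exp (-(lam * (q : ℝ))) * Real.exp lam
        ≤ 6 * ((q : ℝ) ^ 2)⁻¹ := by
      intro q hq
      have hq1 : (1 : ℝ) ≤ q := by exact_mod_cast (Finset.mem_Icc.1 hq).1
      have := Real.pow_div_factorial_le_exp (q : ℝ) (by positivity) 2
      norm_num [Nat.factorial] at this
      have hle : Real.exp (-(lam * (q : ℝ))) * Real.exp lam ≤ Real.exp 1 * (Real.exp q)⁻¹ := by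
        rw [← Real.exp_neg, ← Real.exp_add, ← Real.exp_add, Real.exp_le_exp]
        nlinarith
      refine hle.trans ?_
      have hinv : (Real.exp q)⁻¹ ≤ ((q : ℝ) ^ 2 / 2)⁻¹ :=
        inv_anti₀ (by positivity) this
      refine (mul_le_mul he hinv (by positivity) (by norm_num)).trans (le_of_eq ?_)
      rw [inv_div]
      ring
    have hs := (Finset.sum_le_sum h)
    rw [← Finset.sum_mul, ← Finset.mul_sum] at hs
    have := sum_inv_sq_le K
    have hs2 : (∑ q ∈ Finset.Icc 1 K, Real.exp (-(lam * (q : ℝ)))) * Real.exp lam ≤ 12 := by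
      linarith
    rw [mul_assoc]
    have := mul_le_mul_of_nonneg_left hs2 hc.le
    linarith

lemma sum_ratio_mul_lipWeight_sq_le (a : Weighting) (K : ℕ) {lam c κ : ℝ} (hl : 0 < lam)
    (hc : 0 < c) (hκ : 0 < κ)
    (hsum : c * ∑ q ∈ Finset.Icc 1 K, Real.exp (-(lam * (q : ℝ))) ≤ 1) {ratio : ℕ → ℝ}
    (hr : ExpLabelCount K lam c κ ratio) :
    ∑ q ∈ Finset.Icc 1 K, ratio q * a.lipWeight K q ^ 2
      ≤ 48 * (κ * (1 + c)) * a.rateFactor K lam := by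
  have h : ∑ q ∈ Finset.Icc 1 K, ratio q * a.lipWeight K q ^ 2
      ≤ ∑ q ∈ Finset.Icc 1 K,
          κ * (c * Real.exp (-(lam * (q : ℝ)))) * a.lipWeight K q ^ 2 :=
    Finset.sum_le_sum fun q hq => mul_le_mul_of_nonneg_right (hr q hq) (sq_nonneg _)
  refine h.trans ?_
  have hexp := mul_sum_exp_le K hc hsum
  cases a
  · have e : ∑ q ∈ Finset.Icc 1 K,
        κ * (c * Real.exp (-(lam * (q : ℝ)))) * Weighting.one.lipWeight K q ^ 2
        = κ * c * ∑ q ∈ Finset.Icc 1 K, Real.exp (-(lam * (q : ℝ))) * (q : ℝ) ^ 2 := by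
      rw [Finset.mul_sum]
      refine Finset.sum_congr rfl fun q hq => ?_
      simp only [Weighting.lipWeight, hq, if_true]
      ring
    rw [e]
    refine (mul_le_mul_of_nonneg_left (sum_exp_mul_sq_le K hl) (by positivity)).trans ?_
    have : 0 ≤ κ * (48 / lam ^ 4) := by positivity
    simp only [Weighting.rateFactor]
    calc κ * c * (48 / lam ^ 4) ≤ κ * c * (48 / lam ^ 4) + κ * (48 / lam ^ 4) := by linarith
      _ = _ := by ring
  · have e : ∑ q ∈ Finset.Icc 1 K,
        κ * (c * Real.exp (-(lam * (q : ℝ)))) * Weighting.two.lipWeight K q ^ 2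
        = κ * (c * ∑ q ∈ Finset.Icc 1 K, Real.exp (-(lam * (q : ℝ)))) := by
      rw [Finset.mul_sum, Finset.mul_sum]
      refine Finset.sum_congr rfl fun q hq => ?_
      simp only [Weighting.lipWeight, hq, if_true]
      ring
    rw [e]
    refine (mul_le_mul_of_nonneg_left hexp hκ.le).trans (le_of_eq ?_)
    simp only [Weighting.rateFactor]
    ring
  · have e : ∑ q ∈ Finset.Icc 1 K,
        κ * (c * Real.exp (-(lam * (q : ℝ)))) * Weighting.three.lipWeight K q ^ 2
        = κ * (1 / K) ^ 2 * (c * ∑ q ∈ Finset.Icc 1 K, Real.exp (-(lam * (q : ℝ)))) := by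
      rw [Finset.mul_sum, Finset.mul_sum]
      refine Finset.sum_congr rfl fun q hq => ?_
      simp only [Weighting.lipWeight, hq, if_true]
      ring
    rw [e]
    refine (mul_le_mul_of_nonneg_left hexp (by positivity)).trans (le_of_eq ?_)
    simp only [Weighting.rateFactor, one_div, mul_inv]
    ring

/-- The complexity term controls the Rademacher bound of the linear class. -/
lemma rademacher_bound_le_rate (a : Weighting) {C N K : ℕ} (hN : 1 ≤ N) {Λ r lam c κ T : ℝ}
    (hΛ : 0 ≤ Λ) (hr : 0 < r) (hc : 0 < c) (hκ : 0 < κ) (μ : NNReal)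
    (hT : T ≤ N * (48 * (κ * (1 + c)) * a.rateFactor K lam)) :
    2 * (2 * Λ * r * √(C * (16 * μ ^ 2 * T)))
      ≤ N * (112 * μ * √(κ * (1 + c)) * a.rate C N K Λ r lam) := by
  have hN0 : (0 : ℝ) < N := by exact_mod_cast hN
  -- The constant 28 is chosen by 16 · 48 = 768 ≤ 784 = 28²; then 2 · 2 · 28 = 112.
  have h : √(C * (16 * μ ^ 2 * T))
      ≤ √((28 * μ) ^ 2 * (N * (C * (κ * (1 + c) * a.rateFactor K lam)))) := by
    refine Real.sqrt_le_sqrt ?_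
    have h1 := mul_le_mul_of_nonneg_left hT (by positivity : (0 : ℝ) ≤ C * (16 * μ ^ 2))
    have hf : 0 ≤ a.rateFactor K lam := by cases a <;> simp only [Weighting.rateFactor] <;> positivity
    have h2 : (0 : ℝ) ≤ μ ^ 2 * (N * (C * (κ * (1 + c) * a.rateFactor K lam))) := by positivity
    linarith
  refine (mul_le_mul_of_nonneg_left
    (mul_le_mul_of_nonneg_left h (by positivity)) zero_le_two).trans (le_of_eq ?_)
  rw [Real.sqrt_mul (sq_nonneg _), Real.sqrt_sq (by positivity), a.rate_eq,
    show 112 * (μ : ℝ) * √(κ * (1 + c)) * √(C * Λ ^ 2 * r ^ 2 / N * a.rateFactor K lam)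
      = 112 * μ * (√(κ * (1 + c)) * √(C * Λ ^ 2 * r ^ 2 / N * a.rateFactor K lam)) by ring,
    ← Real.sqrt_mul (by positivity),
    show κ * (1 + c) * (C * Λ ^ 2 * r ^ 2 / N * a.rateFactor K lam)
      = (Λ * r / N) ^ 2 * (N * (C * (κ * (1 + c) * a.rateFactor K lam))) by field_simp,
    Real.sqrt_mul (sq_nonneg _), Real.sqrt_sq (by positivity)]
  field_simp
  ring

/-! ### From per-sample weights to label-count ratios -/

/-- Written through indicators of the label count, so that averaging over the sample or over `D`
turns them into the ratios. -/
lemma Weighting.lipWeight_sq_eq_sum (a : Weighting) (K q : ℕ) :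
    a.lipWeight K q ^ 2
      = ∑ p ∈ Finset.Icc 1 K, (if q = p then 1 else 0) * a.lipWeight K p ^ 2 := by
  simp only [ite_mul, one_mul, zero_mul, Finset.sum_ite_eq]
  split_ifs with h
  · rfl
  · simp [lipWeight, h]

lemma sum_lipWeight_sq_eq {X : Type*} {C N : ℕ} (hN : 1 ≤ N) (a : Weighting) (K : ℕ)
    (S : Fin N → X × Label C) :
    ∑ n, a.lipWeight K (numRelevant (S n).2) ^ 2
      = N * ∑ q ∈ Finset.Icc 1 K, sampleRatio S q * a.lipWeight K q ^ 2 := by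
  have hN0 : (N : ℝ) ≠ 0 := by positivity
  simp only [a.lipWeight_sq_eq_sum K (numRelevant _)]
  rw [Finset.sum_comm, Finset.mul_sum]
  refine Finset.sum_congr rfl fun q _ => ?_
  rw [← Finset.sum_mul, Finset.sum_boole, sampleRatio]
  field_simp

lemma measurable_of_label {X : Type*} [MeasurableSpace X] {C : ℕ} (F : Label C → ℝ) :
    Measurable fun z : X × Label C => F z.2 :=
  (measurable_of_countable F).comp measurable_snd

lemma integral_lipWeight_sq_eq {X : Type*} [MeasurableSpace X] {C : ℕ}
    (D : Measure (X × Label C)) [IsProbabilityMeasure D] (a : Weighting) (K : ℕ) :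
    ∫ z, a.lipWeight K (numRelevant z.2) ^ 2 ∂D
      = ∑ q ∈ Finset.Icc 1 K, populationRatio D q * a.lipWeight K q ^ 2 := by
  simp only [a.lipWeight_sq_eq_sum K (numRelevant _)]
  have hi : ∀ q, Integrable
      (fun z : X × Label C => if numRelevant z.2 = q then (1 : ℝ) else 0) D := fun q =>
    integrable_of_abs_le (B := 1) (measurable_of_label fun y => if numRelevant y = q then 1 else 0)
      fun z => by split_ifs <;> simp
  rw [integral_finsetSum _ fun q _ => (hi q).mul_const _]
  refine Finset.sum_congr rfl fun q _ => ?_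
  rw [integral_mul_const, populationRatio]
  congr 1
  have hm : MeasurableSet {z : X × Label C | numRelevant z.2 = q} :=
    measurable_snd (Set.toFinite {y : Label C | numRelevant y = q}).measurableSet
  rw [← integral_indicator_one hm]
  refine integral_congr_ae (Filter.Eventually.of_forall fun z => ?_)
  simp [Set.indicator_apply]

/-! ### Uniform deviation over the ball of kernel models -/

section KernelModel

variable {X H : Type*} [NormedAddCommGroup H] [InnerProductSpace ℝ H]
  {φ : X → H} {C N K : ℕ} {a : Weighting} {g : ℝ → ℝ} {μ : NNReal} {M r Λ lam c κ δ : ℝ}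

lemma continuous_kernelModel (x : X) : Continuous fun W : Fin C → H => kernelModel φ W x :=
  continuous_pi fun j => (continuous_apply j).inner continuous_const

lemma rademacher_kernelModel_le {ι : Type*} [Finite ι] [Nonempty ι] (hr : 0 < r)
    (hφr : ∀ x, ‖φ x‖ ≤ r) (hg : LipschitzWith μ g) (W : ι → Fin C → H)
    (hW : ∀ i, paramNorm (W i) ≤ Λ) (S : Fin N → X × Label C) :
    rademacher (fun i z => truncLoss a K g (kernelModel φ (W i) z.1) z.2) S
      ≤ 2 * Λ * r * √(C * (16 * μ ^ 2 * ∑ n, a.lipWeight K (numRelevant (S n).2) ^ 2)) := by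
  have h := rademacher_linear_le W hW (fun n => φ (S n).1) hr.le (fun n => hφr _)
    (fun n i => truncLoss a K g (kernelModel φ (W i) (S n).1) (S n).2)
    (fun n => 4 * μ * a.lipWeight K (numRelevant (S n).2))
    (fun n => mul_nonneg (by positivity) (a.lipWeight_nonneg _ _))
    (fun n i i' => abs_truncLoss_sub_le a K hg _ _ _)
  refine h.trans (le_of_eq ?_)
  congr 3
  rw [Finset.mul_sum]
  exact Finset.sum_congr rfl fun n _ => by ring

/-- The radius of the uniform deviation bound. -/
noncomputable def deviationRadius (a : Weighting) (C N K : ℕ) (M Λ r lam c κ δ : ℝ) (μ : NNReal) :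
    ℝ :=
  3 * a.lossBound K M * √(Real.log (2 / δ) / (2 * (N : ℝ)))
    + 112 * μ * √(κ * (1 + c)) * a.rate C N K Λ r lam

variable [MeasurableSpace X]

lemma measurable_truncLoss_kernelModel (hφ : StronglyMeasurable φ) (hg : LipschitzWith μ g)
    (W : Fin C → H) :
    Measurable fun z : X × Label C => truncLoss a K g (kernelModel φ W z.1) z.2 := by
  refine measurable_from_prod_countable_left fun y => ?_
  refine (continuous_truncLoss a K hg y).measurable.comp (measurable_pi_iff.2 fun j => ?_)
  exact ((innerSL ℝ (W j)).continuous.comp_stronglyMeasurable hφ).measurable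

/-- The truncated risk exceeds its empirical counterpart by at most the deviation radius. -/
def DeviationBound (D : Measure (X × Label C)) (φ : X → H) (a : Weighting) (K : ℕ) (g : ℝ → ℝ)
    (R : ℝ) (S : Fin N → X × Label C) (W : Fin C → H) : Prop :=
  ∫ z, truncLoss a K g (kernelModel φ W z.1) z.2 ∂D
    ≤ 1 / (N : ℝ) * ∑ n, truncLoss a K g (kernelModel φ W (S n).1) (S n).2 + R

variable (D : Measure (X × Label C)) [IsProbabilityMeasure D]

/-- Concavity of the square root moves the expectation inside the empirical bound, where the squared
weights average to population ratios. -/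
lemma integral_rademacher_kernelModel_le {ι : Type*} [Finite ι] [Nonempty ι] (hr : 0 < r)
    (hφ : StronglyMeasurable φ) (hφr : ∀ x, ‖φ x‖ ≤ r) (hg : LipschitzWith μ g) (hM : 0 ≤ M)
    (hg0 : ∀ t, 0 ≤ g t) (hgM : ∀ t, g t ≤ M) (W : ι → Fin C → H) (hΛ : 0 ≤ Λ)
    (hW : ∀ i, paramNorm (W i) ≤ Λ) :
    ∫ S : Fin N → X × Label C,
        rademacher (fun i z => truncLoss a K g (kernelModel φ (W i) z.1) z.2) S
        ∂Measure.pi (fun _ => D)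
      ≤ 2 * Λ * r * √(C * (16 * μ ^ 2
          * (N * ∑ q ∈ Finset.Icc 1 K, populationRatio D q * a.lipWeight K q ^ 2))) := by
  set P := Measure.pi (fun _ : Fin N => D)
  set F : (Fin N → X × Label C) → ℝ :=
    fun S => C * (16 * μ ^ 2 * ∑ n, a.lipWeight K (numRelevant (S n).2) ^ 2) with hF
  obtain ⟨b, hb⟩ : ∃ b, ∀ y : Label C, a.lipWeight K (numRelevant y) ^ 2 ≤ b := by
    obtain ⟨b, hb⟩ := (Set.finite_range fun y : Label C =>
      a.lipWeight K (numRelevant y) ^ 2).bddAbove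
    exact ⟨b, fun y => hb ⟨y, rfl⟩⟩
  have hwm : Measurable fun z : X × Label C => a.lipWeight K (numRelevant z.2) ^ 2 :=
    measurable_of_label fun y => a.lipWeight K (numRelevant y) ^ 2
  have hwi : Integrable (fun z : X × Label C => a.lipWeight K (numRelevant z.2) ^ 2) D :=
    integrable_of_abs_le (B := b) hwm fun z => by
      rw [abs_of_nonneg (sq_nonneg _)]; exact hb _
  have hwin : ∀ n ∈ Finset.univ, Integrable
      (fun S : Fin N → X × Label C => a.lipWeight K (numRelevant (S n).2) ^ 2) P := fun n _ =>
    (measurePreserving_eval (fun _ : Fin N => D) n).integrable_comp_of_integrable hwi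
  have hFm : Measurable F := ((Finset.measurable_sum _ fun n _ =>
    hwm.comp (measurable_pi_apply n)).const_mul _).const_mul _
  have hF0 : ∀ S, 0 ≤ F S := fun S => by positivity
  have hFi : Integrable F P := ((integrable_finsetSum _ hwin).const_mul _).const_mul _
  have hsFi : Integrable (fun S => √(F S)) P := by
    refine (hFi.add (integrable_const 1)).mono' hFm.sqrt.aestronglyMeasurable
      (Filter.Eventually.of_forall fun S => ?_)
    rw [Real.norm_eq_abs, abs_of_nonneg (Real.sqrt_nonneg _)]
    refine Real.sqrt_le_iff.2 ⟨add_nonneg (hF0 S) zero_le_one, ?_⟩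
    show F S ≤ (F S + 1) ^ 2
    nlinarith [hF0 S]
  have hFint : ∫ S, F S ∂P = C * (16 * μ ^ 2
      * (N * ∑ q ∈ Finset.Icc 1 K, populationRatio D q * a.lipWeight K q ^ 2)) := by
    simp only [hF]
    rw [integral_const_mul, integral_const_mul, integral_finsetSum _ hwin]
    have : ∀ n : Fin N, ∫ S : Fin N → X × Label C, a.lipWeight K (numRelevant (S n).2) ^ 2 ∂P
        = ∑ q ∈ Finset.Icc 1 K, populationRatio D q * a.lipWeight K q ^ 2 := fun n => by
      rw [← integral_lipWeight_sq_eq]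
      exact integral_comp_measurePreserving (measurePreserving_eval (fun _ : Fin N => D) n) hwm
    simp [this]
  have hrad : Integrable (fun S : Fin N → X × Label C =>
      rademacher (fun i z => truncLoss a K g (kernelModel φ (W i) z.1) z.2) S) P :=
    integrable_of_abs_le
      (measurable_rademacher fun i => measurable_truncLoss_kernelModel hφ hg (W i))
      (abs_rademacher_le (fun i z => truncLoss_nonneg a K hg0 _ _)
        fun i z => truncLoss_le a K hM hgM _ _)
  refine (integral_mono hrad (hsFi.const_mul (2 * Λ * r)) fun S =>
    rademacher_kernelModel_le hr hφr hg W hW S).trans ?_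
  rw [integral_const_mul, ← hFint]
  refine mul_le_mul_of_nonneg_left ?_ (by positivity)
  exact Real.strictConcaveOn_sqrt.concaveOn.le_map_integral
    Real.continuous_sqrt.continuousOn isClosed_Ici (Filter.Eventually.of_forall hF0) hFi hsFi

/-- The uniform deviation bound for finitely many kernel models. -/
lemma measure_finite_kernelModel_le {ι : Type*} [Finite ι] [Nonempty ι] (hN : 1 ≤ N)
    (hr : 0 < r) (hφ : StronglyMeasurable φ) (hφr : ∀ x, ‖φ x‖ ≤ r) (hg : LipschitzWith μ g)
    (hM : 0 ≤ M) (hg0 : ∀ t, 0 ≤ g t) (hgM : ∀ t, g t ≤ M) (hΛ : 0 ≤ Λ) (hl : 0 < lam)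
    (hc : 0 < c) (hκ : 0 < κ)
    (hsum : c * ∑ q ∈ Finset.Icc 1 K, Real.exp (-(lam * (q : ℝ))) ≤ 1) (hδ0 : 0 < δ)
    (hδ1 : δ < 1) (W : ι → Fin C → H) (hW : ∀ i, paramNorm (W i) ≤ Λ) :
    Measure.pi (fun _ : Fin N => D)
      {S | (ExpLabelCount K lam c κ (sampleRatio S)
          ∨ ExpLabelCount K lam c κ (populationRatio D)) ∧
        ¬ ∀ i, DeviationBound D φ a K g (deviationRadius a C N K M Λ r lam c κ δ μ) S (W i)}
      ≤ ENNReal.ofReal δ := by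
  have hN0 : (0 : ℝ) < N := by exact_mod_cast hN
  refine (measure_mono fun S hS => ?_).trans (measure_deviation_le D hN
    (fun i => measurable_truncLoss_kernelModel hφ hg (W i))
    (fun i z => truncLoss_nonneg a K hg0 _ _) (fun i z => truncLoss_le a K hM hgM _ _) hδ0 hδ1)
  rintro ⟨h1, h2⟩
  refine hS.2 fun i => ?_
  have hlog : 0 ≤ Real.log (2 / δ) := Real.log_nonneg (by rw [le_div_iff₀ hδ0]; linarith)
  have hsq : √(N * Real.log (2 / δ) / 2) = N * √(Real.log (2 / δ) / (2 * (N : ℝ))) := by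
    rw [show (N : ℝ) * Real.log (2 / δ) / 2 = N ^ 2 * (Real.log (2 / δ) / (2 * N)) by
      field_simp, Real.sqrt_mul (sq_nonneg _), Real.sqrt_sq hN0.le]
  have key : ∑ n, ((∫ z, truncLoss a K g (kernelModel φ (W i) z.1) z.2 ∂D)
      - truncLoss a K g (kernelModel φ (W i) (S n).1) (S n).2)
      ≤ N * (112 * μ * √(κ * (1 + c)) * a.rate C N K Λ r lam)
        + 3 * a.lossBound K M * √(N * Real.log (2 / δ) / 2) := by
    -- Sample ratios go with the empirical Rademacher average, population ratios with the expected
    -- one.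
    rcases hS.1 with hE | hE
    · refine (h1 i).trans (add_le_add_left ?_ _)
      refine (mul_le_mul_of_nonneg_left (rademacher_kernelModel_le hr hφr hg W hW S)
        zero_le_two).trans (rademacher_bound_le_rate a hN hΛ hr hc hκ μ ?_)
      rw [sum_lipWeight_sq_eq hN]
      exact mul_le_mul_of_nonneg_left
        (sum_ratio_mul_lipWeight_sq_le a K hl hc hκ hsum hE) hN0.le
    · refine (h2 i).trans (add_le_add_left ?_ _)
      refine (mul_le_mul_of_nonneg_left
        (integral_rademacher_kernelModel_le D hr hφ hφr hg hM hg0 hgM W hΛ hW)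
        zero_le_two).trans (rademacher_bound_le_rate a hN hΛ hr hc hκ μ ?_)
      exact mul_le_mul_of_nonneg_left
        (sum_ratio_mul_lipWeight_sq_le a K hl hc hκ hsum hE) hN0.le
  rw [Finset.sum_sub_distrib, Finset.sum_const, Finset.card_univ, Fintype.card_fin,
    nsmul_eq_mul, hsq] at key
  rw [DeviationBound, deviationRadius]
  refine le_of_mul_le_mul_left ?_ hN0
  rw [mul_add, ← mul_assoc, mul_one_div_cancel hN0.ne', one_mul, mul_add]
  linarith

/-- Both sides are continuous in the parameters, the risk by dominated convergence. This carries the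
bound from a countable family to its closure. -/
lemma isClosed_deviationBound (hφ : StronglyMeasurable φ) (hg : LipschitzWith μ g) (hM : 0 ≤ M)
    (hg0 : ∀ t, 0 ≤ g t) (hgM : ∀ t, g t ≤ M) (R : ℝ) (S : Fin N → X × Label C) :
    IsClosed {W : Fin C → H | DeviationBound D φ a K g R S W} := by
  have hcont : ∀ z : X × Label C,
      Continuous fun W : Fin C → H => truncLoss a K g (kernelModel φ W z.1) z.2 := fun z =>
    (continuous_truncLoss a K hg z.2).comp (continuous_kernelModel z.1)
  refine isClosed_le ?_ ((continuous_const.mul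
    (continuous_finsetSum _ fun n _ => hcont (S n))).add continuous_const)
  refine continuous_of_dominated (bound := fun _ => a.lossBound K M)
    (fun W => (measurable_truncLoss_kernelModel hφ hg W).aestronglyMeasurable)
    (fun W => Filter.Eventually.of_forall fun z => ?_) (integrable_const _)
    (Filter.Eventually.of_forall hcont)
  rw [Real.norm_eq_abs, abs_of_nonneg (truncLoss_nonneg a K hg0 _ _)]
  exact truncLoss_le a K hM hgM _ _

/-- A countable family of parameters that suffices for closed properties of kernel models. -/
lemma exists_dense_params [CompleteSpace H] (hφ : StronglyMeasurable φ) (hΛ : 0 ≤ Λ) :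
    ∃ W : ℕ → Fin C → H, (∀ k, paramNorm (W k) ≤ Λ) ∧
      ∀ V : Fin C → H, paramNorm V ≤ Λ →
        ∃ V' ∈ closure (Set.range W), kernelModel φ V' = kernelModel φ V := by
  -- `H` need not be separable, but strong measurability makes the range of `φ`, and hence `U`,
  -- separable. Projecting parameters onto `U` leaves the model unchanged and does not increase the
  -- norm.
  set U : Submodule ℝ H := (Submodule.span ℝ (Set.range φ)).topologicalClosure with hU
  have hUc : CompleteSpace U :=
    (Submodule.isClosed_topologicalClosure _).completeSpace_coe
  have hsepU : TopologicalSpace.IsSeparable (U : Set H) := by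
    rw [hU, Submodule.topologicalClosure_coe]
    exact hφ.isSeparable_range.span.closure
  set s : Set (Fin C → H) := {V | (∀ j, V j ∈ U) ∧ paramNorm V ≤ Λ} with hs
  have hseps : TopologicalSpace.IsSeparable s :=
    (TopologicalSpace.IsSeparable.univ_pi fun _ => hsepU).mono fun V hV j _ => hV.1 j
  obtain ⟨t, hts, htc, hst⟩ := hseps.exists_countable_dense_subset
  have h0 : (0 : Fin C → H) ∈ s := ⟨fun j => U.zero_mem, by simpa [paramNorm] using hΛ⟩
  have htne : t.Nonempty := closure_nonempty_iff.1 ⟨0, hst h0⟩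
  obtain ⟨W, rfl⟩ := htc.exists_eq_range htne
  refine ⟨W, fun k => (hts ⟨k, rfl⟩).2, fun V hV => ⟨fun j => U.starProjection (V j),
    hst ⟨fun j => U.starProjection_apply_mem _, ?_⟩, ?_⟩⟩
  · refine le_trans (Real.sqrt_le_sqrt (Finset.sum_le_sum fun j _ => ?_)) hV
    exact pow_le_pow_left₀ (norm_nonneg _) (U.norm_starProjection_apply_le _) 2
  · funext x j
    have hx : φ x ∈ U := Submodule.le_topologicalClosure _ (Submodule.subset_span ⟨x, rfl⟩)
    simp only [kernelModel]
    rw [U.inner_starProjection_left_eq_right, Submodule.starProjection_eq_self_iff.2 hx]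

/-- The uniform deviation bound for the truncated loss on the ball of kernel models. -/
theorem measure_kernelModel_le [CompleteSpace H] (hN : 1 ≤ N)
    (hr : 0 < r) (hφ : StronglyMeasurable φ) (hφr : ∀ x, ‖φ x‖ ≤ r) (hg : LipschitzWith μ g)
    (hM : 0 ≤ M) (hg0 : ∀ t, 0 ≤ g t) (hgM : ∀ t, g t ≤ M) (hΛ : 0 ≤ Λ) (hl : 0 < lam)
    (hc : 0 < c) (hκ : 0 < κ)
    (hsum : c * ∑ q ∈ Finset.Icc 1 K, Real.exp (-(lam * (q : ℝ))) ≤ 1) (hδ0 : 0 < δ)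
    (hδ1 : δ < 1) :
    Measure.pi (fun _ : Fin N => D)
      {S | (ExpLabelCount K lam c κ (sampleRatio S)
          ∨ ExpLabelCount K lam c κ (populationRatio D)) ∧
        ¬ ∀ V : Fin C → H, paramNorm V ≤ Λ →
          DeviationBound D φ a K g (deviationRadius a C N K M Λ r lam c κ δ μ) S V}
      ≤ ENNReal.ofReal δ := by
  obtain ⟨W, hW, hdense⟩ := exists_dense_params (C := C) hφ hΛ
  set R := deviationRadius a C N K M Λ r lam c κ δ μ with hR
  set bad : ℕ → Set (Fin N → X × Label C) := fun m =>
    {S | (ExpLabelCount K lam c κ (sampleRatio S)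
          ∨ ExpLabelCount K lam c κ (populationRatio D)) ∧
        ¬ ∀ i : Fin (m + 1), DeviationBound D φ a K g R S (W i)} with hbad
  -- The bad events increase with the finite subfamily, so continuity from below keeps the level δ
  -- without a union bound.
  have hmono : Monotone bad := fun m m' hm S hS =>
    ⟨hS.1, fun h => hS.2 fun i => h ⟨i, by omega⟩⟩
  have hle : Measure.pi (fun _ : Fin N => D) (⋃ m, bad m) ≤ ENNReal.ofReal δ := by
    rw [hmono.measure_iUnion]
    exact iSup_le fun m => measure_finite_kernelModel_le D hN hr hφ hφr hg hM hg0 hgM hΛ hl hc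
      hκ hsum hδ0 hδ1 (fun i : Fin (m + 1) => W i) fun i => hW i
  refine (measure_mono fun S hS => ?_).trans hle
  by_contra hcon
  refine hS.2 fun V hV => ?_
  have hall : ∀ k, DeviationBound D φ a K g R S (W k) := by
    intro k
    by_contra hk
    exact hcon (Set.mem_iUnion.2 ⟨k, hS.1, fun h => hk (h ⟨k, by omega⟩)⟩)
  have hcl := closure_minimal (s := Set.range W) (by rintro _ ⟨k, rfl⟩; exact hall k)
    (isClosed_deviationBound (a := a) (K := K) D hφ hg hM hg0 hgM R S)
  obtain ⟨V', hV', hVV⟩ := hdense V hV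
  have := hcl hV'
  simp only [Set.mem_ofPred_eq, DeviationBound, hVV] at this
  exact this

end KernelModel

/-! ### Transfer to the original surrogate -/

/-- A surrogate extends to a bounded Lipschitz function on the line. -/
lemma IsSurrogate.exists_extension {ell : ℝ → ℝ} {I : Set ℝ} {μ : NNReal} {M : ℝ}
    (h : IsSurrogate ell I μ M) (hM : 0 ≤ M) :
    ∃ g : ℝ → ℝ, LipschitzWith μ g ∧ (∀ t, 0 ≤ g t) ∧ (∀ t, g t ≤ M) ∧ Set.EqOn ell g I := by
  obtain ⟨g, hg, he⟩ := h.lipschitz.extend_real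
  -- Clamping the Lipschitz extension to [0, M] preserves the Lipschitz constant and changes nothing
  -- on `I`.
  refine ⟨fun t => max 0 (min M (g t)), (hg.const_min M).const_max 0, fun t => le_max_left _ _,
    fun t => max_le hM (min_le_left _ _), fun t ht => ?_⟩
  show ell t = max 0 (min M (g t))
  rw [← he ht, min_eq_right (h.le_bound t ht), max_eq_right (h.nonneg t ht)]

lemma surrogateLoss_congr {C : ℕ} (a : Weighting) (K : ℕ) {ell g : ℝ → ℝ} {I : Set ℝ}
    (h : Set.EqOn ell g I) {s : Fin C → ℝ} (hs : ∀ i j, s i - s j ∈ I) (y : Label C) :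
    surrogateLoss a K ell s y = surrogateLoss a K g s y := by
  unfold surrogateLoss
  congr 1
  exact Finset.sum_congr rfl fun i _ => Finset.sum_congr rfl fun k _ => h (hs _ _)

end TKPR

theorem mainTheorem12 :
    ∃ A : ℝ, 0 < A ∧
      ∀ (X : Type*) [MeasurableSpace X]
        (H : Type*) [NormedAddCommGroup H] [InnerProductSpace ℝ H] [CompleteSpace H]
        (ker : X → X → ℝ) (φ : X → H) (_ : ∀ x x', ker x x' = inner ℝ (φ x) (φ x'))
        (_ : StronglyMeasurable φ)
        (r : ℝ) (_ : 0 < r) (_ : ∀ x, ker x x ≤ r ^ 2)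
        (Λ : ℝ) (_ : 0 ≤ Λ)
        (C N K : ℕ) (_ : 1 ≤ N) (_ : 1 ≤ K) (_ : K < C)
        (D : Measure (X × TKPR.Label C)) [IsProbabilityMeasure D]
        (_ : ∀ᵐ z ∂D, TKPR.numRelevant z.2 ≤ K)
        (I : Set ℝ)
        (_ : ∀ f ∈ TKPR.kernelClass C φ Λ, ∀ x i j, f x i - f x j ∈ I)
        (ell : ℝ → ℝ) (μ : NNReal) (M : ℝ) (_ : TKPR.IsSurrogate ell I μ M)
        (lam c κ : ℝ) (_ : 0 < lam) (_ : 0 < c) (_ : 0 < κ)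
        (_ : c * ∑ q ∈ Finset.Icc 1 K, Real.exp (-(lam * (q : ℝ))) ≤ 1)
        (δ : ℝ) (_ : 0 < δ) (_ : δ < 1)
        (a : TKPR.Weighting),
        (∀ f ∈ TKPR.kernelClass C φ Λ,
          Integrable (fun z : X × TKPR.Label C => TKPR.surrogateLoss a K ell (f z.1) z.2) D) ∧
        Measure.pi (fun _ : Fin N => D)
          {S | TKPR.ExpLabelCount K lam c κ (TKPR.sampleRatio S) ∧
            ¬ ∀ f ∈ TKPR.kernelClass C φ Λ,
              TKPR.risk D a K ell f ≤ TKPR.Phi S a K ell M δ f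
                + A * μ * √(κ * (1 + c)) * a.rate C N K Λ r lam} ≤ ENNReal.ofReal δ ∧
        (TKPR.ExpLabelCount K lam c κ (TKPR.populationRatio D) →
          Measure.pi (fun _ : Fin N => D)
            {S | ¬ ∀ f ∈ TKPR.kernelClass C φ Λ,
              TKPR.risk D a K ell f ≤ TKPR.Phi S a K ell M δ f
                + A * μ * √(κ * (1 + c)) * a.rate C N K Λ r lam} ≤ ENNReal.ofReal δ) := by

  refine ⟨112, by norm_num, ?_⟩
  intro X _ H _ _ _ ker φ hker hφ r hr hkr Λ hΛ C N K hN hK hKC D _ hD I hI ell μ M hell lam c κ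
    hl hc hκ hsum δ hδ0 hδ1 a
  have hφr : ∀ x, ‖φ x‖ ≤ r := fun x => by
    have := hkr x
    rw [hker, real_inner_self_eq_norm_sq] at this
    exact le_of_sq_le_sq this hr.le
  obtain ⟨z₀⟩ : Nonempty (X × TKPR.Label C) := nonempty_of_isProbabilityMeasure D
  have hM : 0 ≤ M := by
    -- The zero model supplies a point of `I`, where 0 ≤ ℓ ≤ M.
    have h0 := hI _ ⟨0, by simpa [TKPR.paramNorm] using hΛ, rfl⟩ z₀.1 ⟨0, by omega⟩ ⟨0, by omega⟩
    exact (hell.nonneg _ h0).trans (hell.le_bound _ h0)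
  obtain ⟨g, hg, hg0, hgM, heq⟩ := hell.exists_extension hM
  have hloss : ∀ W : Fin C → H, TKPR.paramNorm W ≤ Λ → ∀ z : X × TKPR.Label C,
      TKPR.numRelevant z.2 ≤ K →
      TKPR.surrogateLoss a K ell (TKPR.kernelModel φ W z.1) z.2
        = TKPR.truncLoss a K g (TKPR.kernelModel φ W z.1) z.2 := fun W hW z hz => by
    rw [TKPR.truncLoss_eq a g _ hz]
    exact TKPR.surrogateLoss_congr a K heq (hI _ ⟨W, hW, rfl⟩ z.1) z.2
  have hae : ∀ W : Fin C → H, TKPR.paramNorm W ≤ Λ →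
      (fun z : X × TKPR.Label C => TKPR.truncLoss a K g (TKPR.kernelModel φ W z.1) z.2)
        =ᵐ[D] fun z => TKPR.surrogateLoss a K ell (TKPR.kernelModel φ W z.1) z.2 :=
    fun W hW => hD.mono fun z hz => (hloss W hW z hz).symm
  have hS : ∀ᵐ S ∂Measure.pi (fun _ : Fin N => D), ∀ n, TKPR.numRelevant (S n).2 ≤ K :=
    ae_all_iff.2 fun n => (Measure.quasiMeasurePreserving_eval (fun _ : Fin N => D) n).ae hD
  have hmain := TKPR.measure_kernelModel_le (a := a) D hN hr hφ hφr hg hM hg0 hgM hΛ hl hc hκ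
    hsum hδ0 hδ1
  have hbound : ∀ S : Fin N → X × TKPR.Label C, (∀ n, TKPR.numRelevant (S n).2 ≤ K) →
      (∀ V : Fin C → H, TKPR.paramNorm V ≤ Λ → TKPR.DeviationBound D φ a K g
        (TKPR.deviationRadius a C N K M Λ r lam c κ δ μ) S V) →
      ∀ f ∈ TKPR.kernelClass C φ Λ, TKPR.risk D a K ell f ≤ TKPR.Phi S a K ell M δ f
        + 112 * μ * √(κ * (1 + c)) * a.rate C N K Λ r lam := by
    rintro S hSK hV f ⟨W, hW, rfl⟩
    have h := hV W hW
    rw [TKPR.DeviationBound, integral_congr_ae (hae W hW), TKPR.deviationRadius,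
      ← Finset.sum_congr rfl fun n _ => hloss W hW (S n) (hSK n)] at h
    rw [TKPR.risk, TKPR.Phi, TKPR.empiricalRisk]
    linarith
  refine ⟨?_, ?_, fun hpop => ?_⟩
  · rintro f ⟨W, hW, rfl⟩
    refine (TKPR.integrable_of_abs_le (TKPR.measurable_truncLoss_kernelModel hφ hg W)
      (B := a.lossBound K M) fun z => ?_).congr (hae W hW)
    rw [abs_of_nonneg (TKPR.truncLoss_nonneg a K hg0 _ _)]
    exact TKPR.truncLoss_le a K hM hgM _ _
  -- Almost every sample has all label counts at most `K`, where truncated and original losses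
  -- agree; almost-everywhere inclusion bounds outer measure, so the bad set need not be measurable.
  · refine (measure_mono_ae ?_).trans hmain
    filter_upwards [hS] with S hSK hbad
    exact ⟨Or.inl hbad.1, fun h => hbad.2 (hbound S hSK h)⟩
  · refine (measure_mono_ae ?_).trans hmain
    filter_upwards [hS] with S hSK hbad
    exact ⟨Or.inr hpop, fun h => hbad (hbound S hSK h)⟩
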